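/- Let $m^\pm\ge 1$ be integers. Consider the eigenvalue problem $$-u''=\lambda u \ \text{ on } (-1,1),\qquad \alpha_0^\pm u(\pm1)+\beta_0^\pm u'(\pm1)=\sum_{i=1}^{m^\pm}\alpha_i^\pm u(\eta_i^\pm)+\sum_{i=1}^{m^\pm}\beta_i^\pm u'(\eta_i^\pm),\tag{1}$$ for $u\in C^2[-1,1]$, $\lambda\in\mathbb R$. Let $\mathcal P$ be the set of all real parameters $p=(\alpha_0^\pm,\beta_0^\pm,\alpha^\pm,\beta^\pm,\eta^\pm)$, with $\alpha^\pm,\beta^\pm\in\mathbb R^{m^\pm}$, such that $\eta^-\in(-1,1]^{m^-}$, $\eta^+\in[-1,1)^{m^+}$ and, for each sign, $$\alpha_0^\pm\ge0,\quad \alpha_0^\pm+|\beta_0^\pm|>0,\quad \pm\beta_0^\pm\ge0,\quad \Big(\frac{\sum_i|\alpha_i^\pm|}{\alpha_0^\pm}\Big)^2+\Big(\frac{\sum_i|\beta_i^\pm|}{\beta_0^\pm}\Big)^2<1,$$ where, if a denominator is zero, the corresponding numerator must also be zero and the fraction is omitted. Give $\mathcal P$ the topology of a subset of a Euclidean space.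 For $\lambda>0$ let $\omega^-_{\lambda,0}\in[0,\pi/2]$ and $\omega^+_{\lambda,0}\in[\pi/2,\pi]$ be the angles with $\tan\omega^\pm_{\lambda,0}=-\lambda^{1/2}\beta_0^\pm/\alpha_0^\pm$ (equal to $\pi/2$ if $\alpha_0^\pm=0$). For $k\ge 0$ let $P_k^+$ be the set of pairs $(\lambda,u)$, with $\lambda>0$ and $u\in C^1[-1,1]$ having only simple zeros, for which some continuous determination $\omega$ on $[-1,1]$ of the angle from $(1,0)$ to $(u',\lambda^{1/2}u)$ satisfies $$|\omega(-1)-\omega^-_{\lambda,0}|<\pi/2,\qquad |\omega(1)-\omega^+_{\lambda,0}-k\pi|<\pi/2 .$$ For each $p\in\mathcal P$ the eigenvalues of (1) form a strictly increasing sequence $\lambda_0(p)<\lambda_1(p)<\cdots$, and for each $k\ge0$ there is exactly one eigenfunction $u_k(p)$ of $\lambda_k(p)$ which has the form $u_k(p)(x)=\sin(\lambda_k(p)^{1/2}x+\theta)$ for some $\theta\in\mathbb R$ and satisfies $(\lambda_k(p),u_k(p))\in P_k^+$ if $\lambda_k(p)\neq0$, and $u_k(p)\equiv1$ if $\lambda_k(p)=0$.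 Moreover, for each $k\ge0$, the maps $p\mapsto\lambda_k(p)\in\mathbb R$ and $p\mapsto u_k(p)\in C^0[-1,1]$ (with the sup norm) are continuous on $\mathcal P$. -/

import Mathlib

open Set

noncomputable section

namespace MultiPoint

/-- The data `(α₀, β₀, α, β, η)` of one multi-point boundary condition with `m` interior terms,
with the product topology of `ℝ × ℝ × ℝᵐ × ℝᵐ × ℝᵐ`. -/
abbrev BCData (m : ℕ) : Type :=
  ℝ × ℝ × (Fin m → ℝ) × (Fin m → ℝ) × (Fin m → ℝ)

namespace BCData

variable {m : ℕ}

abbrev alpha0 (d : BCData m) : ℝ := d.1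
abbrev beta0 (d : BCData m) : ℝ := d.2.1
abbrev alpha (d : BCData m) : Fin m → ℝ := d.2.2.1
abbrev beta (d : BCData m) : Fin m → ℝ := d.2.2.2.1
abbrev eta (d : BCData m) : Fin m → ℝ := d.2.2.2.2

end BCData

/-- The conditions on the coefficients of the boundary condition at the end point `ν = ±1`:
`α₀ ≥ 0`, `α₀ + |β₀| > 0`, `ν β₀ ≥ 0` and
`(∑ |αᵢ| / α₀)² + (∑ |βᵢ| / β₀)² < 1`. If a denominator is zero then the corresponding numerator
must be zero and the fraction is omitted; the omission is what Lean's `x / 0 = 0` does. -/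
structure CoeffAdmissible {m : ℕ} (ν : ℝ) (d : BCData m) : Prop where
  alpha0_nonneg : 0 ≤ d.alpha0
  nontrivial : 0 < d.alpha0 + |d.beta0|
  sign : 0 ≤ ν * d.beta0
  alpha_eq_zero : d.alpha0 = 0 → ∑ i, |d.alpha i| = 0
  beta_eq_zero : d.beta0 = 0 → ∑ i, |d.beta i| = 0
  bound : ((∑ i, |d.alpha i|) / d.alpha0) ^ 2 + ((∑ i, |d.beta i|) / d.beta0) ^ 2 < 1

/-- The admissible parameters: first component at the end point `-1`, second one at `+1`;
`η⁻ ∈ (-1,1]^{m⁻}` and `η⁺ ∈ [-1,1)^{m⁺}`. The topology is the subspace topology. -/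
abbrev Param (mMinus mPlus : ℕ) : Type :=
  {p : BCData mMinus × BCData mPlus //
    CoeffAdmissible (-1) p.1 ∧ CoeffAdmissible 1 p.2 ∧
      (∀ i, p.1.eta i ∈ Ioc (-1 : ℝ) 1) ∧ (∀ i, p.2.eta i ∈ Ico (-1 : ℝ) 1)}

/-- The derivative on `[-1,1]` (one-sided at the end points). -/
def D (u : ℝ → ℝ) : ℝ → ℝ := derivWithin u (Icc (-1) 1)

/-- `α₀ u(ν) + β₀ u'(ν) = ∑ αᵢ u(ηᵢ) + ∑ βᵢ u'(ηᵢ)`, where `ν = ±1`. -/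
def BoundaryCondition {m : ℕ} (ν : ℝ) (d : BCData m) (u : ℝ → ℝ) : Prop :=
  d.alpha0 * u ν + d.beta0 * D u ν =
    ∑ i, d.alpha i * u (d.eta i) + ∑ i, d.beta i * D u (d.eta i)

variable {mMinus mPlus : ℕ}

/-- `u` (of which only the values on `[-1,1]` matter) is an eigenfunction for `lam`: a nontrivial
`C²[-1,1]` solution of `-u'' = lam u` on `(-1,1)` satisfying both boundary conditions. -/
structure IsEigenfunction (p : Param mMinus mPlus) (lam : ℝ) (u : ℝ → ℝ) : Prop where
  contDiffOn : ContDiffOn ℝ 2 u (Icc (-1) 1)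
  equation : ∀ x ∈ Ioo (-1 : ℝ) 1, -(D (D u) x) = lam * u x
  bc_minus : BoundaryCondition (-1) p.1.1 u
  bc_plus : BoundaryCondition 1 p.1.2 u
  nontrivial : ∃ x ∈ Icc (-1 : ℝ) 1, u x ≠ 0

/-- The spectrum: the set of (real) eigenvalues. -/
def spec (p : Param mMinus mPlus) : Set ℝ :=
  {lam | ∃ u : ℝ → ℝ, IsEigenfunction p lam u}

/-- `ω` is a (modified) Prüfer angle of `u`: a continuous determination on `[-1,1]` of the angle
between the vectors `(u', lam^{1/2} u)` and `(1,0)`. -/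
def IsPruferAngle (lam : ℝ) (u ω : ℝ → ℝ) : Prop :=
  ContinuousOn ω (Icc (-1) 1) ∧
    ∀ x ∈ Icc (-1 : ℝ) 1, ∃ ρ : ℝ, 0 < ρ ∧
      D u x = ρ * Real.cos (ω x) ∧ Real.sqrt lam * u x = ρ * Real.sin (ω x)

/-- The angle `-arctan (lam^{1/2} β₀⁻ / α₀⁻)`, in `[0, π/2]`. -/
def omegaMinus (p : Param mMinus mPlus) (lam : ℝ) : ℝ :=
  if p.1.1.alpha0 = 0 then Real.pi / 2
  else -Real.arctan (Real.sqrt lam * p.1.1.beta0 / p.1.1.alpha0)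

/-- The determination in `[π/2, π]` of the angle `-arctan (lam^{1/2} β₀⁺ / α₀⁺)` modulo `π`. -/
def omegaPlus (p : Param mMinus mPlus) (lam : ℝ) : ℝ :=
  if p.1.2.alpha0 = 0 then Real.pi / 2
  else Real.pi - Real.arctan (Real.sqrt lam * p.1.2.beta0 / p.1.2.alpha0)

/-- `(lam, u) ∈ P_k⁺`: `lam > 0`, `u ∈ C¹[-1,1]` has only simple zeros, and the Prüfer angle of `u`
is within `π/2` of `ω_{lam,0}^-` at `-1` and of `ω_{lam,0}^+ + kπ` at `1`. (The condition at `-1`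
selects the continuous determination of the angle; the existence of an angle at `x` forces
`(u(x), u'(x)) ≠ 0`.) -/
def InPPlus (p : Param mMinus mPlus) (k : ℕ) (lam : ℝ) (u : ℝ → ℝ) : Prop :=
  0 < lam ∧ ContDiffOn ℝ 1 u (Icc (-1) 1) ∧
    ∃ ω : ℝ → ℝ, IsPruferAngle lam u ω ∧
      |ω (-1) - omegaMinus p lam| < Real.pi / 2 ∧
      |ω 1 - omegaPlus p lam - k * Real.pi| < Real.pi / 2

/-- The normalisation of the eigenfunction `u_k` of the eigenvalue `lam = λ_k`: it has the form
`x ↦ sin (lam^{1/2} x + θ)` and `(lam, u_k) ∈ P_k⁺`; if `lam = 0` (Neumann-type conditions, `k = 0`)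
it is the constant function `1 = sin (0 · x + π/2)`. -/
structure IsNormalizedEigenfunction (p : Param mMinus mPlus) (k : ℕ) (lam : ℝ)
    (u : ℝ → ℝ) : Prop where
  eigenfunction : IsEigenfunction p lam u
  form : ∃ θ : ℝ, ∀ x ∈ Icc (-1 : ℝ) 1, u x = Real.sin (Real.sqrt lam * x + θ)
  oscillation : lam ≠ 0 → InPPlus p k lam u
  of_eq_zero : lam = 0 → ∀ x ∈ Icc (-1 : ℝ) 1, u x = 1

/-- A function in `C⁰[-1,1]` as a function on `ℝ`, extended by constants outside `[-1,1]`. -/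
def extendC (f : C(Icc (-1 : ℝ) 1, ℝ)) : ℝ → ℝ :=
  IccExtend (by norm_num : (-1 : ℝ) ≤ 1) f

end MultiPoint

end

noncomputable section

namespace MultiPoint

/-! ### The boundary symbol, bounds on its argument, and two inequalities for complex numbers. -/

section

/-! For `λ = s² > 0` every solution is a multiple of `sin (s x + θ)`. The boundary condition at `1`
says that `e^{i(s+θ)} * symbol d s` is real, that is `sin (θ + phase d s) = 0`. Reflecting the
interval turns the condition at `-1` into `sin (θ - phase (reflect d) s) = 0`. Eliminating `θ`, `s²`
is an eigenvalue iff `totalPhase p s`, the sum of the two phases, is a multiple of `π`.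

The coefficient condition is used twice. By Cauchy-Schwarz the nonlocal terms are smaller than `α₀ +
i s β₀`, so the symbol stays within angle `π/2` of it (`abs_arg_symbol_sub_lt`); the argument is
then continuous, and this bound is also the oscillation condition of `P_k⁺`. In addition, each phase
is strictly increasing (`phase_deriv_pos`). The total phase starts in `[0, π]` and tends to
infinity, so it takes each value `(k + 1) π` exactly once, at `freq p k`; this is `0` only for `k =
0` with Neumann-type conditions at both ends. An energy and convexity argument (`neumann_of_nonpos`)
excludes all other eigenvalues `≤ 0`.

Continuity in `p` follows from monotonicity in `s` and continuity in the data at each fixed `s > 0`.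
The phases jump at `s = 0` when `α₀` reaches `0`, but each phase at `freq p k` is upper
semicontinuous in `p`, and the two add up to the constant `(k + 1) π`, so both are continuous. -/

open Complex in
/-- `(α₀ + i s β₀) - ∑ (αᵢ + i s βᵢ) e^{-i s (1 - ηᵢ)}`: the boundary condition at `1` holds for
`x ↦ sin (s x + θ)` iff the product of this number with `e^{i (s + θ)}` is real. -/
def symbol {m : ℕ} (d : BCData m) (s : ℝ) : ℂ :=
  ((d.alpha0 : ℂ) + (s * d.beta0 : ℝ) * I) -
    ∑ i, ((d.alpha i : ℂ) + (s * d.beta i : ℝ) * I) * exp ((-(s * (1 - d.eta i)) : ℝ) * I)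

/-- The continuous increasing determination of the argument of `e^{i s} * symbol d s` on `[0, ∞)`;
at `s = 0` the symbol may vanish, and the value is the limit. -/
def phase {m : ℕ} (d : BCData m) (s : ℝ) : ℝ :=
  if s = 0 then (if d.alpha0 = 0 then Real.pi / 2 else 0) else s + (symbol d s).arg

/-- The boundary data at `1` obtained by the reflection `x ↦ -x` from data at `-1`. -/
def reflect {m : ℕ} (d : BCData m) : BCData m :=
  (d.alpha0, -d.beta0, d.alpha, -d.beta, -d.eta)

variable {m : ℕ} {d : BCData m} {ν s : ℝ}

@[simp] theorem reflect_alpha0 : (reflect d).alpha0 = d.alpha0 := rfl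
@[simp] theorem reflect_beta0 : (reflect d).beta0 = -d.beta0 := rfl
@[simp] theorem reflect_alpha (i : Fin m) : (reflect d).alpha i = d.alpha i := rfl
@[simp] theorem reflect_beta (i : Fin m) : (reflect d).beta i = -d.beta i := rfl
@[simp] theorem reflect_eta (i : Fin m) : (reflect d).eta i = -d.eta i := rfl

/-- A division-free form of the coefficient condition, in which vanishing denominators need no
separate case. -/
theorem CoeffAdmissible.exists_ratio (h : CoeffAdmissible ν d) :
    ∃ a b : ℝ, 0 ≤ a ∧ 0 ≤ b ∧ a ^ 2 + b ^ 2 < 1 ∧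
      ∑ i, |d.alpha i| = a * d.alpha0 ∧ ∑ i, |d.beta i| = b * |d.beta0| := by
  have hA : 0 ≤ ∑ i, |d.alpha i| := Finset.sum_nonneg fun i _ => abs_nonneg _
  have hB : 0 ≤ ∑ i, |d.beta i| := Finset.sum_nonneg fun i _ => abs_nonneg _
  refine ⟨(∑ i, |d.alpha i|) / d.alpha0, (∑ i, |d.beta i|) / |d.beta0|,
    div_nonneg hA h.alpha0_nonneg, div_nonneg hB (abs_nonneg _), ?_, ?_, ?_⟩
  · have := h.bound
    rwa [div_pow (∑ i, |d.beta i|), sq_abs, ← div_pow]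
  · by_cases h0 : d.alpha0 = 0
    · rw [h.alpha_eq_zero h0]; simp
    · rw [div_mul_cancel₀ _ h0]
  · by_cases h0 : d.beta0 = 0
    · rw [h.beta_eq_zero h0]; simp
    · rw [div_mul_cancel₀ _ (abs_ne_zero.2 h0)]

theorem CoeffAdmissible.reflect (h : CoeffAdmissible (-1) d) : CoeffAdmissible 1 (reflect d) where
  alpha0_nonneg := h.alpha0_nonneg
  nontrivial := by simpa using h.nontrivial
  sign := by simpa using h.sign
  alpha_eq_zero := h.alpha_eq_zero
  beta_eq_zero := by simpa using h.beta_eq_zero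
  bound := by simpa [div_neg] using h.bound

theorem CoeffAdmissible.beta0_nonneg (h : CoeffAdmissible 1 d) : 0 ≤ d.beta0 := by
  simpa using h.sign

theorem CoeffAdmissible.sum_norm_lt (h : CoeffAdmissible 1 d) (hs : 0 < s) :
    ∑ i, ‖(d.alpha i : ℂ) + (s * d.beta i : ℝ) * Complex.I‖ <
      ‖(d.alpha0 : ℂ) + (s * d.beta0 : ℝ) * Complex.I‖ := by
  obtain ⟨a, b, ha, hb, hab, hA, hB⟩ := h.exists_ratio
  have h0 := h.alpha0_nonneg
  have h1 := h.beta0_nonneg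
  have hn := h.nontrivial
  rw [abs_of_nonneg h1] at hB hn
  have h2 : 0 ≤ s * d.beta0 := mul_nonneg hs.le h1
  have key : ∑ i, ‖(d.alpha i : ℂ) + (s * d.beta i : ℝ) * Complex.I‖ ≤
      a * d.alpha0 + b * (s * d.beta0) := by
    calc ∑ i, ‖(d.alpha i : ℂ) + (s * d.beta i : ℝ) * Complex.I‖
        ≤ ∑ i, (|d.alpha i| + s * |d.beta i|) := by
          refine Finset.sum_le_sum fun i _ => (norm_add_le _ _).trans ?_
          rw [norm_mul, Complex.norm_I, mul_one, Complex.norm_real, Complex.norm_real,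
            Real.norm_eq_abs, Real.norm_eq_abs, abs_mul, abs_of_pos hs]
      _ = _ := by rw [Finset.sum_add_distrib, ← Finset.mul_sum, hA, hB]; ring
  refine key.trans_lt ?_
  rw [Complex.norm_add_mul_I]
  apply Real.lt_sqrt_of_sq_lt
  have hpos : 0 < d.alpha0 ^ 2 + (s * d.beta0) ^ 2 := by
    rcases h0.eq_or_lt with h0 | h0
    · have : 0 < d.beta0 := by linarith
      positivity
    · positivity
  -- Cauchy-Schwarz for `(a, b)` and `(α₀, s β₀)`, with `a² + b² < 1`.
  nlinarith [sq_nonneg (a * (s * d.beta0) - b * d.alpha0), mul_lt_mul_of_pos_right hab hpos]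

theorem norm_mul_exp_ofReal_mul_I (z : ℂ) (t : ℝ) : ‖z * Complex.exp (t * Complex.I)‖ = ‖z‖ := by
  rw [norm_mul, Complex.norm_exp_ofReal_mul_I, mul_one]

theorem re_mul_conj_pos_of_norm_sub_lt {z w : ℂ} (h : ‖w‖ < ‖z‖) :
    0 < ((z - w) * (starRingEnd ℂ) z).re := by
  have h1 : (w * (starRingEnd ℂ) z).re ≤ ‖w‖ * ‖z‖ := by
    refine (Complex.re_le_norm _).trans ?_
    rw [norm_mul, Complex.norm_conj]
  have h2 : (z * (starRingEnd ℂ) z).re = ‖z‖ * ‖z‖ := by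
    rw [Complex.mul_conj, Complex.ofReal_re, Complex.normSq_eq_norm_sq, sq]
  rw [sub_mul, Complex.sub_re, h2]
  nlinarith [norm_nonneg w]

theorem CoeffAdmissible.re_symbol_mul_conj_pos (h : CoeffAdmissible 1 d) (hs : 0 < s) :
    0 < (symbol d s *
      (starRingEnd ℂ) ((d.alpha0 : ℂ) + (s * d.beta0 : ℝ) * Complex.I)).re := by
  refine re_mul_conj_pos_of_norm_sub_lt ((norm_sum_le _ _).trans_lt ?_)
  simp only [norm_mul_exp_ofReal_mul_I]
  exact h.sum_norm_lt hs

/-- The symbol makes an acute angle with a vector of the closed first quadrant, so it is not on the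
closed negative real axis. -/
theorem CoeffAdmissible.symbol_mem_slitPlane (h : CoeffAdmissible 1 d) (hs : 0 < s) :
    symbol d s ∈ Complex.slitPlane := by
  have h1 := h.re_symbol_mul_conj_pos hs
  have h0 := h.alpha0_nonneg
  rw [Complex.mem_slitPlane_iff]
  by_contra! hc
  have : 0 < (symbol d s).re * d.alpha0 := by
    simpa [Complex.mul_re, hc.2] using h1
  nlinarith [hc.1]

/-- The angle `arctan (s β₀ / α₀)`, with the value `π / 2` if `α₀ = 0`. -/
def baseAngle (d : BCData m) (s : ℝ) : ℝ :=
  if d.alpha0 = 0 then Real.pi / 2 else Real.arctan (s * d.beta0 / d.alpha0)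

theorem CoeffAdmissible.abs_arg_symbol_sub_lt (h : CoeffAdmissible 1 d) (hs : 0 < s) :
    |(symbol d s).arg - baseAngle d s| < Real.pi / 2 := by
  have h1 := h.re_symbol_mul_conj_pos hs
  have h0 := h.alpha0_nonneg
  have hb := h.beta0_nonneg
  have hQ : 0 < ‖symbol d s‖ := norm_pos_iff.2 (Complex.slitPlane_ne_zero (h.symbol_mem_slitPlane hs))
  have hδ : 0 ≤ baseAngle d s ∧ baseAngle d s ≤ Real.pi / 2 ∧ ∃ r : ℝ, 0 < r ∧
      d.alpha0 = r * Real.cos (baseAngle d s) ∧ s * d.beta0 = r * Real.sin (baseAngle d s) := by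
    unfold baseAngle
    split_ifs with hz
    · refine ⟨by positivity, le_rfl, s * d.beta0, ?_, by simp [hz], by simp⟩
      have := h.nontrivial
      rw [hz, abs_of_nonneg hb] at this
      have : 0 < d.beta0 := by linarith
      positivity
    · have hp : 0 < d.alpha0 := lt_of_le_of_ne h0 (Ne.symm hz)
      refine ⟨Real.arctan_nonneg.2 (by positivity), (Real.arctan_lt_pi_div_two _).le,
        d.alpha0 / Real.cos (Real.arctan (s * d.beta0 / d.alpha0)), ?_, ?_, ?_⟩
      · exact div_pos hp (Real.cos_arctan_pos _)
      · rw [div_mul_cancel₀ _ (Real.cos_arctan_pos _).ne']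
      · rw [div_mul_eq_mul_div, mul_div_assoc, ← Real.tan_eq_sin_div_cos, Real.tan_arctan]
        field_simp
  obtain ⟨hδ0, hδ1, r, hr, hc, hsn⟩ := hδ
  set δ := baseAngle d s
  -- The difference lies in `(-3π/2, π]`, where a positive cosine forces absolute value below `π/2`.
  have hcos : 0 < Real.cos ((symbol d s).arg - δ) := by
    have e1 := Complex.norm_mul_cos_arg (symbol d s)
    have e2 := Complex.norm_mul_sin_arg (symbol d s)
    rw [hc, hsn] at h1
    simp only [Complex.mul_re, Complex.conj_re, Complex.conj_im, Complex.add_re, Complex.add_im,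
      Complex.ofReal_re, Complex.ofReal_im, Complex.mul_im, Complex.I_re, Complex.I_im] at h1
    rw [← e1, ← e2] at h1
    rw [Real.cos_sub]
    have : 0 < (‖symbol d s‖ * r) * (Real.cos (symbol d s).arg * Real.cos δ +
      Real.sin (symbol d s).arg * Real.sin δ) := by
        convert h1 using 1; ring
    exact (pos_iff_pos_of_mul_pos this).1 (mul_pos hQ hr)
  have hl := Complex.neg_pi_lt_arg (symbol d s)
  have hu := Complex.arg_le_pi (symbol d s)
  rw [abs_lt]
  constructor
  · by_contra! hcon
    have := Real.cos_nonpos_of_pi_div_two_le_of_le (x := -((symbol d s).arg - δ))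
      (by linarith) (by linarith)
    rw [Real.cos_neg] at this
    linarith
  · by_contra! hcon
    have := Real.cos_nonpos_of_pi_div_two_le_of_le (x := ((symbol d s).arg - δ))
      (by linarith) (by linarith)
    linarith

/-- Splitting the `y i` with weights `(1 ± t i) / 2` into sums `a` and `b` makes the real part `‖x -
a‖² - ‖b‖²`, while `‖a‖ + ‖b‖ < ‖x‖`. -/
theorem re_sub_weighted_mul_conj_pos {ι : Type*} [Fintype ι] {x : ℂ} {y : ι → ℂ} {t : ι → ℝ}
    (ht : ∀ i, |t i| ≤ 1) (h : ∑ i, ‖y i‖ < ‖x‖) :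
    0 < ((x - ∑ i, (t i : ℂ) * y i) * (starRingEnd ℂ) (x - ∑ i, y i)).re := by
  set a : ℂ := ∑ i, (((1 + t i) / 2 : ℝ) : ℂ) * y i with ha
  set b : ℂ := ∑ i, (((1 - t i) / 2 : ℝ) : ℂ) * y i with hb
  have hab : ‖a‖ + ‖b‖ ≤ ∑ i, ‖y i‖ := by
    calc ‖a‖ + ‖b‖ ≤ ∑ i, (1 + t i) / 2 * ‖y i‖ + ∑ i, (1 - t i) / 2 * ‖y i‖ := by
          refine add_le_add ((norm_sum_le _ _).trans_eq (Finset.sum_congr rfl fun i _ => ?_))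
            ((norm_sum_le _ _).trans_eq (Finset.sum_congr rfl fun i _ => ?_))
          · rw [norm_mul, Complex.norm_real, Real.norm_of_nonneg]
            linarith [(abs_le.1 (ht i)).1]
          · rw [norm_mul, Complex.norm_real, Real.norm_of_nonneg]
            linarith [(abs_le.1 (ht i)).2]
      _ = _ := by
          rw [← Finset.sum_add_distrib]
          exact Finset.sum_congr rfl fun i _ => by ring
  have h1 : ∑ i, y i = a + b := by
    rw [ha, hb, ← Finset.sum_add_distrib]
    exact Finset.sum_congr rfl fun i _ => by push_cast; ring
  have h2 : ∑ i, (t i : ℂ) * y i = a - b := by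
    rw [ha, hb, ← Finset.sum_sub_distrib]
    exact Finset.sum_congr rfl fun i _ => by push_cast; ring
  have h3 : ((x - (a - b)) * (starRingEnd ℂ) (x - (a + b))).re = ‖x - a‖ ^ 2 - ‖b‖ ^ 2 := by
    rw [← Complex.normSq_eq_norm_sq, ← Complex.normSq_eq_norm_sq, Complex.normSq_apply,
      Complex.normSq_apply]
    simp [Complex.mul_re]
    ring
  rw [h1, h2, h3]
  have h4 : ‖x‖ - ‖a‖ ≤ ‖x - a‖ := norm_sub_norm_le x a
  nlinarith [norm_nonneg b]

theorem re_one_sub_mul_conj_nonneg {z w : ℂ} (h : ‖z‖ ^ 2 + ‖w‖ ^ 2 ≤ 1) :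
    0 ≤ ((1 - z) * (starRingEnd ℂ) (1 - w)).re := by
  have h1 : 2 * ((1 - z) * (starRingEnd ℂ) (1 - w)).re =
      ‖1 - z - w‖ ^ 2 + (1 - ‖z‖ ^ 2 - ‖w‖ ^ 2) := by
    rw [← Complex.normSq_eq_norm_sq, ← Complex.normSq_eq_norm_sq, ← Complex.normSq_eq_norm_sq,
      Complex.normSq_apply, Complex.normSq_apply, Complex.normSq_apply]
    simp [Complex.mul_re]
    ring
  nlinarith [sq_nonneg ‖1 - z - w‖]

/-- After division by `α₀ β₀` this is `re_one_sub_mul_conj_nonneg`; the sum-of-squares form of the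
coefficient condition is what that inequality needs. -/
theorem CoeffAdmissible.re_beta_mul_conj_alpha_nonneg (h : CoeffAdmissible 1 d) {e : Fin m → ℂ}
    (he : ∀ i, ‖e i‖ = 1) :
    0 ≤ (((d.beta0 : ℂ) - ∑ i, (d.beta i : ℂ) * e i) *
      (starRingEnd ℂ) ((d.alpha0 : ℂ) - ∑ i, (d.alpha i : ℂ) * e i)).re := by
  obtain ⟨a, b, ha, hb, hab, hA, hB⟩ := h.exists_ratio
  have h0 := h.alpha0_nonneg
  have h1 := h.beta0_nonneg
  rw [abs_of_nonneg h1] at hB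
  have hT : ‖∑ i, (d.alpha i : ℂ) * e i‖ ≤ a * d.alpha0 := by
    rw [← hA]
    refine (norm_sum_le _ _).trans_eq (Finset.sum_congr rfl fun i _ => ?_)
    rw [norm_mul, he, mul_one, Complex.norm_real, Real.norm_eq_abs]
  have hU : ‖∑ i, (d.beta i : ℂ) * e i‖ ≤ b * d.beta0 := by
    rw [← hB]
    refine (norm_sum_le _ _).trans_eq (Finset.sum_congr rfl fun i _ => ?_)
    rw [norm_mul, he, mul_one, Complex.norm_real, Real.norm_eq_abs]
  set T := ∑ i, (d.alpha i : ℂ) * e i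
  set U := ∑ i, (d.beta i : ℂ) * e i
  rcases h0.eq_or_lt with hz | hp
  · rw [← hz, mul_zero] at hT
    rw [← hz, norm_le_zero_iff.1 hT]
    simp
  rcases h1.eq_or_lt with hz | hq
  · rw [← hz, mul_zero] at hU
    rw [← hz, norm_le_zero_iff.1 hU]
    simp
  have hz : ‖U / d.beta0‖ ≤ b := by
    rw [norm_div, Complex.norm_real, Real.norm_of_nonneg h1, div_le_iff₀ hq]; exact hU
  have hw : ‖T / d.alpha0‖ ≤ a := by
    rw [norm_div, Complex.norm_real, Real.norm_of_nonneg h0, div_le_iff₀ hp]; exact hT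
  have key := re_one_sub_mul_conj_nonneg (z := U / d.beta0) (w := T / d.alpha0)
    (by nlinarith [norm_nonneg (U / d.beta0), norm_nonneg (T / d.alpha0)])
  have hp' : (d.alpha0 : ℂ) ≠ 0 := by exact_mod_cast hp.ne'
  have hq' : (d.beta0 : ℂ) ≠ 0 := by exact_mod_cast hq.ne'
  have : ((d.beta0 : ℂ) - U) * (starRingEnd ℂ) ((d.alpha0 : ℂ) - T) =
      ((d.beta0 * d.alpha0 : ℝ) : ℂ) *
        ((1 - U / d.beta0) * (starRingEnd ℂ) (1 - T / d.alpha0)) := by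
    simp only [map_sub, map_div₀, Complex.conj_ofReal, map_one]
    push_cast
    field_simp
  rw [this, Complex.re_ofReal_mul]
  positivity

end

/-! ### Monotonicity and continuity of the phase. -/

section

variable {m : ℕ} {d : BCData m} {ν s : ℝ}

theorem continuous_symbol : Continuous fun q : BCData m × ℝ => symbol q.1 q.2 := by
  unfold symbol
  fun_prop

theorem continuous_symbol_left (s : ℝ) : Continuous fun d : BCData m => symbol d s :=
  continuous_symbol.comp (Continuous.prodMk_left s)

open Complex in
theorem hasDerivAt_symbol (d : BCData m) (s : ℝ) :
    HasDerivAt (symbol d)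
      (I * (d.beta0 - ∑ i, (d.beta i : ℂ) * exp ((-(s * (1 - d.eta i)) : ℝ) * I)) +
        I * ∑ i, ((1 - d.eta i : ℝ) : ℂ) *
          (((d.alpha i : ℂ) + (s * d.beta i : ℝ) * I) *
            exp ((-(s * (1 - d.eta i)) : ℝ) * I))) s := by
  have hlin : ∀ a b : ℝ, HasDerivAt (fun t : ℝ => (a : ℂ) + (t * b : ℝ) * I) (b * I) s := by
    intro a b
    have := (((hasDerivAt_id s).mul_const b).ofReal_comp.mul_const I).const_add (a : ℂ)
    simpa using this
  have hexp : ∀ t : ℝ, HasDerivAt (fun r : ℝ => exp ((-(r * t) : ℝ) * I))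
      (exp ((-(s * t) : ℝ) * I) * (((-t : ℝ) : ℂ) * I)) s := by
    intro t
    have := (((hasDerivAt_id s).mul_const t).neg.ofReal_comp.mul_const I).cexp
    simpa using this
  have := (hlin d.alpha0 d.beta0).sub (HasDerivAt.fun_sum (u := Finset.univ) fun i _ =>
    (hlin (d.alpha i) (d.beta i)).mul (hexp (1 - d.eta i)))
  refine this.congr_deriv ?_
  rw [mul_sub, Finset.mul_sum, Finset.mul_sum, sub_add, mul_comm I, ← Finset.sum_sub_distrib]
  congr 1
  refine Finset.sum_congr rfl fun i _ => ?_
  push_cast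
  ring

open Complex in
theorem one_add_im_I_mul_div {a w : ℂ} (hw : w ≠ 0) :
    1 + (I * a / w).im = ((w + a) * (starRingEnd ℂ) w).re / normSq w := by
  rw [div_eq_mul_inv, inv_def, ← mul_assoc, im_mul_ofReal, ← div_eq_mul_inv, eq_div_iff
    (normSq_pos.2 hw).ne', add_mul, div_mul_cancel₀ _ (normSq_pos.2 hw).ne', normSq_apply]
  simp only [mul_re, conj_re, conj_im, add_re, add_im, mul_im, I_re, I_im]
  ring

-- With `w` the symbol, the derivative is `1 + Im (w' / w)`. Multiplied by `|w|²` it splits into a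
-- positive term from the factors `e^{-i s (1 - ηᵢ)}`, where `|ηᵢ| ≤ 1` matters, and a nonnegative
-- term `Re (U * conj T)` pairing the `β` and `α` coefficients.
open Complex in
theorem CoeffAdmissible.phase_deriv_pos (h : CoeffAdmissible 1 d) (hη : ∀ i, |d.eta i| ≤ 1)
    (hs : 0 < s) :
    ∃ r, 0 < r ∧ HasDerivAt (fun s => s + (symbol d s).arg) r s := by
  have hQ := h.symbol_mem_slitPlane hs
  have h1 := (hasDerivAt_symbol d s).clog_real hQ
  have h2 := imCLM.hasFDerivAt.comp_hasDerivAt s h1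
  refine ⟨_, ?_, ((hasDerivAt_id s).add h2).congr_of_eventuallyEq (.of_forall fun t => by simp [log_im])⟩
  set e : Fin m → ℂ := fun i => exp ((-(s * (1 - d.eta i)) : ℝ) * I) with he
  set y : Fin m → ℂ := fun i => ((d.alpha i : ℂ) + (s * d.beta i : ℝ) * I) * e i with hy
  set x : ℂ := (d.alpha0 : ℂ) + (s * d.beta0 : ℝ) * I with hx
  set U : ℂ := (d.beta0 : ℂ) - ∑ i, (d.beta i : ℂ) * e i with hU
  set T : ℂ := (d.alpha0 : ℂ) - ∑ i, (d.alpha i : ℂ) * e i with hT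
  have he1 : ∀ i, ‖e i‖ = 1 := fun i => norm_exp_ofReal_mul_I _
  have hyn : ∀ i, ‖y i‖ = ‖(d.alpha i : ℂ) + (s * d.beta i : ℝ) * I‖ := fun i =>
    norm_mul_exp_ofReal_mul_I _ _
  have p1 := re_sub_weighted_mul_conj_pos (x := x) (y := y) hη
    (by simp only [hyn]; exact h.sum_norm_lt hs)
  have p2 := h.re_beta_mul_conj_alpha_nonneg he1
  have hsym : symbol d s = x - ∑ i, y i := rfl
  have hsplit : x - ∑ i, y i = T + s * I * U := by
    simp only [hx, hy, hT, hU, mul_sub, Finset.mul_sum, add_mul, Finset.sum_add_distrib]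
    push_cast
    have : ∑ i, (s : ℂ) * I * (d.beta i * e i) = ∑ i, (s : ℂ) * d.beta i * I * e i :=
      Finset.sum_congr rfl fun i _ => by ring
    rw [this]
    ring
  have hweight : ∑ i, ((1 - d.eta i : ℝ) : ℂ) * y i = ∑ i, y i - ∑ i, (d.eta i : ℂ) * y i := by
    rw [← Finset.sum_sub_distrib]
    exact Finset.sum_congr rfl fun i _ => by push_cast; ring
  have hne : symbol d s ≠ 0 := slitPlane_ne_zero hQ
  have key : (1 : ℝ) + ((I * U + I * ∑ i, ((1 - d.eta i : ℝ) : ℂ) * y i) / symbol d s).im =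
      (((x - ∑ i, (d.eta i : ℂ) * y i) * (starRingEnd ℂ) (x - ∑ i, y i)).re +
        (U * (starRingEnd ℂ) T).re) / normSq (symbol d s) := by
    -- The symbol is `T + s i U`, and `s i U` is orthogonal to `U`.
    have e1 : (U * (starRingEnd ℂ) T).re = (U * (starRingEnd ℂ) (symbol d s)).re := by
      rw [hsym, hsplit]
      simp only [mul_re, conj_re, conj_im, add_re, add_im, mul_im, I_re, I_im, ofReal_re, ofReal_im]
      ring
    rw [← mul_add, one_add_im_I_mul_div hne, e1, hweight, ← hsym, ← add_re, ← add_mul, hsym]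
    congr 3
    ring
  have goal_eq : (1 : ℝ) + imCLM ((I * U + I * ∑ i, ((1 - d.eta i : ℝ) : ℂ) * y i) / symbol d s) =
      _ := key
  refine goal_eq.symm ▸ div_pos (by linarith) (normSq_pos.2 hne)

theorem phase_of_pos (d : BCData m) (hs : 0 < s) : phase d s = s + (symbol d s).arg := by
  rw [phase, if_neg hs.ne']

theorem CoeffAdmissible.tendsto_phase (h : CoeffAdmissible 1 d) :
    Filter.Tendsto (phase d) (nhdsWithin 0 (Ioi 0)) (nhds (phase d 0)) := by
  obtain ⟨a, b, ha, hb, hab, hA, hB⟩ := h.exists_ratio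
  have h0 := h.alpha0_nonneg
  have h1 := h.beta0_nonneg
  rw [abs_of_nonneg h1] at hB
  have ha1 : a < 1 := by nlinarith
  have hb1 : b < 1 := by nlinarith
  by_cases hz : d.alpha0 = 0
  · have hα : ∀ i, d.alpha i = 0 := by
      have := h.alpha_eq_zero hz
      rw [Finset.sum_eq_zero_iff_of_nonneg fun i _ => abs_nonneg _] at this
      exact fun i => abs_eq_zero.1 (this i (Finset.mem_univ i))
    have hb0 : 0 < d.beta0 := by
      have := h.nontrivial
      rwa [hz, zero_add, abs_of_nonneg h1] at this
    -- In the Neumann case the symbol is `s * q s`. Removing the positive factor `s` keeps the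
    -- argument, and `q 0` is a positive multiple of `i`.
    let q : ℝ → ℂ := fun s => (d.beta0 : ℂ) * Complex.I - ∑ i, (d.beta i : ℂ) * Complex.I *
      Complex.exp ((-(s * (1 - d.eta i)) : ℝ) * Complex.I)
    have hq : Continuous q := by fun_prop
    have hq0 : q 0 = ((d.beta0 - ∑ i, d.beta i : ℝ) : ℂ) * Complex.I := by
      simp [q, sub_mul, Finset.sum_mul]
    have hpos : 0 < d.beta0 - ∑ i, d.beta i := by
      have : ∑ i, d.beta i ≤ ∑ i, |d.beta i| := Finset.sum_le_sum fun i _ => le_abs_self _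
      nlinarith
    have harg : (q 0).arg = Real.pi / 2 := by
      rw [hq0, Complex.arg_real_mul _ hpos, Complex.arg_I]
    have hslit : q 0 ∈ Complex.slitPlane := by
      rw [Complex.mem_slitPlane_iff, hq0]
      right
      simpa using hpos.ne'
    have ht : Filter.Tendsto (fun s => s + (q s).arg) (nhds 0) (nhds (phase d 0)) := by
      have : ContinuousAt (fun s => s + (q s).arg) 0 :=
        continuousAt_id.add
          (ContinuousAt.comp' (Complex.continuousAt_arg hslit) hq.continuousAt)
      have h2 := this.tendsto
      simpa only [zero_add, harg, phase, if_true, if_pos hz] using h2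
    refine (ht.mono_left nhdsWithin_le_nhds).congr' ?_
    filter_upwards [self_mem_nhdsWithin] with s hs
    rw [phase_of_pos d hs]
    have : symbol d s = (s : ℂ) * q s := by
      simp only [symbol, hz, hα, q, mul_sub, Finset.mul_sum]
      push_cast
      simp only [zero_add]
      congr 1
      · ring
      · exact Finset.sum_congr rfl fun i _ => by ring
    rw [this, Complex.arg_real_mul _ hs]
  · have hp : 0 < d.alpha0 := lt_of_le_of_ne h0 (Ne.symm hz)
    have hq0 : symbol d 0 = ((d.alpha0 - ∑ i, d.alpha i : ℝ) : ℂ) := by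
      simp [symbol]
    have hpos : 0 < d.alpha0 - ∑ i, d.alpha i := by
      have : ∑ i, d.alpha i ≤ ∑ i, |d.alpha i| := Finset.sum_le_sum fun i _ => le_abs_self _
      nlinarith
    have hslit : symbol d 0 ∈ Complex.slitPlane := by
      rw [Complex.mem_slitPlane_iff, hq0]
      left
      simpa using hpos
    have harg : (symbol d 0).arg = 0 := by
      rw [hq0, Complex.arg_ofReal_of_nonneg hpos.le]
    have ht : Filter.Tendsto (fun s => s + (symbol d s).arg) (nhds 0) (nhds (phase d 0)) := by
      have : ContinuousAt (fun s => s + (symbol d s).arg) 0 :=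
        continuousAt_id.add
          (ContinuousAt.comp' (Complex.continuousAt_arg hslit)
            (hasDerivAt_symbol d 0).continuousAt)
      have h2 := this.tendsto
      simpa only [zero_add, harg, phase, if_true, if_neg hz] using h2
    refine (ht.mono_left nhdsWithin_le_nhds).congr' ?_
    filter_upwards [self_mem_nhdsWithin] with s hs
    rw [phase_of_pos d hs]

theorem CoeffAdmissible.exists_hasDerivAt_phase (h : CoeffAdmissible 1 d)
    (hη : ∀ i, |d.eta i| ≤ 1) (hs : 0 < s) : ∃ r, 0 < r ∧ HasDerivAt (phase d) r s := by
  obtain ⟨r, hr, hd⟩ := h.phase_deriv_pos hη hs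
  refine ⟨r, hr, hd.congr_of_eventuallyEq ?_⟩
  filter_upwards [lt_mem_nhds hs] with t ht using phase_of_pos d ht

theorem CoeffAdmissible.continuousOn_phase (h : CoeffAdmissible 1 d)
    (hη : ∀ i, |d.eta i| ≤ 1) : ContinuousOn (phase d) (Ici 0) := by
  intro s hs
  rcases (mem_Ici.1 hs).eq_or_lt with rfl | hs
  · rw [← continuousWithinAt_Ioi_iff_Ici]
    exact h.tendsto_phase
  · obtain ⟨r, -, hd⟩ := h.exists_hasDerivAt_phase hη hs
    exact hd.continuousAt.continuousWithinAt

theorem CoeffAdmissible.strictMonoOn_phase (h : CoeffAdmissible 1 d)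
    (hη : ∀ i, |d.eta i| ≤ 1) : StrictMonoOn (phase d) (Ici 0) := by
  refine strictMonoOn_of_deriv_pos (convex_Ici 0) (h.continuousOn_phase hη) fun s hs => ?_
  rw [interior_Ici] at hs
  obtain ⟨r, hr, hd⟩ := h.exists_hasDerivAt_phase hη hs
  rwa [hd.deriv]

/-- Positivity of `s` is essential: at `s = 0` the phase jumps from `0` to `π/2` when `α₀` reaches
`0`. -/
theorem CoeffAdmissible.continuousAt_phase_left (h : CoeffAdmissible 1 d) (hs : 0 < s) :
    ContinuousAt (fun d : BCData m => phase d s) d := by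
  simp only [phase_of_pos _ hs]
  exact continuousAt_const.add (ContinuousAt.comp'
    (Complex.continuousAt_arg (h.symbol_mem_slitPlane hs)) (continuous_symbol_left s).continuousAt)

theorem phase_zero_nonneg (d : BCData m) : 0 ≤ phase d 0 := by
  rw [phase, if_pos rfl]
  split_ifs <;> positivity

theorem phase_zero_le (d : BCData m) : phase d 0 ≤ Real.pi / 2 := by
  rw [phase, if_pos rfl]
  split_ifs
  · rfl
  · positivity

theorem phase_zero_eq_iff (d : BCData m) : phase d 0 = Real.pi / 2 ↔ d.alpha0 = 0 := by
  rw [phase, if_pos rfl]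
  split_ifs with h
  · simp [h]
  · simpa [h] using Real.pi_div_two_pos.ne

theorem sub_pi_le_phase (d : BCData m) (hs : 0 ≤ s) : s - Real.pi ≤ phase d s := by
  rcases hs.eq_or_lt with rfl | hs
  · linarith [phase_zero_nonneg d, Real.pi_pos]
  · rw [phase_of_pos d hs]
    linarith [Complex.neg_pi_lt_arg (symbol d s)]

end

/-! ### The total phase, the frequencies, and their continuity in the parameter. -/

section

variable {mMinus mPlus : ℕ} (p : Param mMinus mPlus) (k : ℕ)

theorem Param.plus_admissible : CoeffAdmissible 1 p.1.2 := p.2.2.1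

theorem Param.reflect_minus_admissible : CoeffAdmissible 1 (reflect p.1.1) := p.2.1.reflect

theorem Param.abs_eta_minus_le (i : Fin mMinus) : |p.1.1.eta i| ≤ 1 :=
  abs_le.2 ⟨(p.2.2.2.1 i).1.le, (p.2.2.2.1 i).2⟩

theorem Param.abs_eta_plus_le (i : Fin mPlus) : |p.1.2.eta i| ≤ 1 :=
  abs_le.2 ⟨(p.2.2.2.2 i).1, (p.2.2.2.2 i).2.le⟩

theorem Param.abs_eta_reflect_minus_le (i : Fin mMinus) : |(reflect p.1.1).eta i| ≤ 1 := by
  rw [reflect_eta, abs_neg]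
  exact p.abs_eta_minus_le i

theorem continuous_reflect {m : ℕ} : Continuous (reflect : BCData m → BCData m) := by
  unfold reflect
  fun_prop

/-- The number `s ^ 2 > 0` is an eigenvalue iff this total phase is a multiple of `π`. -/
def totalPhase (s : ℝ) : ℝ := phase p.1.2 s + phase (reflect p.1.1) s

theorem strictMonoOn_totalPhase : StrictMonoOn (totalPhase p) (Ici 0) :=
  (p.plus_admissible.strictMonoOn_phase p.abs_eta_plus_le).add
    (p.reflect_minus_admissible.strictMonoOn_phase p.abs_eta_reflect_minus_le)

theorem continuousOn_totalPhase : ContinuousOn (totalPhase p) (Ici 0) :=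
  (p.plus_admissible.continuousOn_phase p.abs_eta_plus_le).add
    (p.reflect_minus_admissible.continuousOn_phase p.abs_eta_reflect_minus_le)

theorem totalPhase_zero_le : totalPhase p 0 ≤ Real.pi := by
  unfold totalPhase
  linarith [phase_zero_le p.1.2, phase_zero_le (reflect p.1.1)]

theorem totalPhase_zero_nonneg : 0 ≤ totalPhase p 0 :=
  add_nonneg (phase_zero_nonneg _) (phase_zero_nonneg _)

theorem totalPhase_zero_eq_iff :
    totalPhase p 0 = Real.pi ↔ p.1.1.alpha0 = 0 ∧ p.1.2.alpha0 = 0 := by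
  have h1 := phase_zero_le p.1.2
  have h2 := phase_zero_le (reflect p.1.1)
  rw [← phase_zero_eq_iff p.1.2, ← reflect_alpha0, ← phase_zero_eq_iff, totalPhase]
  constructor
  · intro h
    constructor <;> linarith
  · rintro ⟨h3, h4⟩
    linarith

theorem exists_totalPhase_eq : ∃ s : ℝ, 0 ≤ s ∧ totalPhase p s = (k + 1) * Real.pi := by
  have hk : (0 : ℝ) ≤ k := k.cast_nonneg
  have hπ := Real.pi_pos
  -- Each phase is at least `M - π` at `M`, so the total phase there exceeds `(k + 1) π`.
  set M : ℝ := (k + 3) * Real.pi with hM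
  have hM0 : 0 ≤ M := by positivity
  have h1 := sub_pi_le_phase p.1.2 hM0
  have h2 := sub_pi_le_phase (reflect p.1.1) hM0
  obtain ⟨s, hs, h⟩ := intermediate_value_Icc hM0
    ((continuousOn_totalPhase p).mono Icc_subset_Ici_self)
    (show (k + 1) * Real.pi ∈ Icc (totalPhase p 0) (totalPhase p M) from
      ⟨(totalPhase_zero_le p).trans (by nlinarith), by unfold totalPhase; nlinarith⟩)
  exact ⟨s, hs.1, h⟩

/-- The square root of the `k`-th eigenvalue. -/
def freq : ℝ := (exists_totalPhase_eq p k).choose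

theorem freq_nonneg : 0 ≤ freq p k := (exists_totalPhase_eq p k).choose_spec.1

theorem totalPhase_freq : totalPhase p (freq p k) = (k + 1) * Real.pi :=
  (exists_totalPhase_eq p k).choose_spec.2

variable {p k}

theorem eq_freq {s : ℝ} (hs : 0 ≤ s) (h : totalPhase p s = (k + 1) * Real.pi) : s = freq p k :=
  (strictMonoOn_totalPhase p).injOn hs (freq_nonneg p k) (h.trans (totalPhase_freq p k).symm)

theorem lt_freq_iff {s : ℝ} (hs : 0 ≤ s) : s < freq p k ↔ totalPhase p s < (k + 1) * Real.pi := by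
  rw [← totalPhase_freq p k]
  exact ((strictMonoOn_totalPhase p).lt_iff_lt hs (freq_nonneg p k)).symm

theorem freq_lt_iff {s : ℝ} (hs : 0 ≤ s) : freq p k < s ↔ (k + 1) * Real.pi < totalPhase p s := by
  rw [← totalPhase_freq p k]
  exact ((strictMonoOn_totalPhase p).lt_iff_lt (freq_nonneg p k) hs).symm

theorem freq_strictMono : StrictMono (freq p) := fun k l hkl => by
  rw [lt_freq_iff (freq_nonneg p k), totalPhase_freq]
  have : (k : ℝ) < l := by exact_mod_cast hkl
  nlinarith [Real.pi_pos]

theorem freq_eq_zero_iff : freq p k = 0 ↔ k = 0 ∧ p.1.1.alpha0 = 0 ∧ p.1.2.alpha0 = 0 := by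
  rw [← totalPhase_zero_eq_iff]
  constructor
  · intro h
    have h1 := totalPhase_freq p k
    rw [h] at h1
    have h2 := totalPhase_zero_le p
    have : (k : ℝ) ≤ 0 := by nlinarith [Real.pi_pos]
    have hk : k = 0 := by exact_mod_cast le_antisymm this k.cast_nonneg
    refine ⟨hk, ?_⟩
    rw [h1, hk]
    simp
  · rintro ⟨rfl, h⟩
    exact (eq_freq le_rfl (by simpa using h)).symm

theorem continuousAt_totalPhase_left {s : ℝ} (hs : 0 < s) :
    ContinuousAt (fun p : Param mMinus mPlus => totalPhase p s) p := by
  have h1 : ContinuousAt (fun p : Param mMinus mPlus => phase p.1.2 s) p :=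
    ContinuousAt.comp' (f := fun p : Param mMinus mPlus => p.1.2)
      (p.plus_admissible.continuousAt_phase_left hs)
      (continuous_snd.comp continuous_subtype_val).continuousAt
  have h2 : ContinuousAt (fun p : Param mMinus mPlus => phase (reflect p.1.1) s) p :=
    ContinuousAt.comp' (f := fun p : Param mMinus mPlus => reflect p.1.1)
      (p.reflect_minus_admissible.continuousAt_phase_left hs)
      (continuous_reflect.comp (continuous_fst.comp continuous_subtype_val)).continuousAt
  exact h1.add h2

theorem eventually_freq_lt {s : ℝ} (hs : freq p k < s) : ∀ᶠ q in nhds p, freq q k < s := by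
  have h0 : 0 < s := (freq_nonneg p k).trans_lt hs
  rw [freq_lt_iff h0.le] at hs
  filter_upwards [(continuousAt_totalPhase_left h0).eventually_const_lt hs] with q hq
  rwa [freq_lt_iff h0.le]

variable (k) in
theorem continuous_freq : Continuous fun p : Param mMinus mPlus => freq p k := by
  rw [continuous_iff_continuousAt]
  intro p
  refine tendsto_order.2 ⟨fun a ha => ?_, fun b hb => eventually_freq_lt hb⟩
  rcases lt_or_ge a 0 with h0 | h0
  · exact .of_forall fun q => h0.trans_le (freq_nonneg q k)
  -- An intermediate `c > 0` is needed because `a` may be `0`, where the total phase need not be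
  -- continuous in `p`.
  · obtain ⟨c, hac, hc⟩ := exists_between ha
    have hc0 : 0 < c := h0.trans_lt hac
    rw [lt_freq_iff hc0.le] at hc
    filter_upwards [(continuousAt_totalPhase_left hc0).eventually_lt_const hc] with q hq
    exact hac.trans ((lt_freq_iff hc0.le).2 hq)

/-- Upper semicontinuity that survives `freq p k = 0`: the phase at `freq q k` is bounded by the
phase at a slightly larger fixed `s > 0`, where it is continuous in the data. -/
theorem eventually_phase_freq_lt {m : ℕ} {f : Param mMinus mPlus → BCData m} (hf : Continuous f)
    (h : ∀ q, CoeffAdmissible 1 (f q)) (hη : ∀ q i, |(f q).eta i| ≤ 1) {c : ℝ}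
    (hc : phase (f p) (freq p k) < c) : ∀ᶠ q in nhds p, phase (f q) (freq q k) < c := by
  have h0 := freq_nonneg p k
  have h1 : ContinuousWithinAt (phase (f p)) (Ioi (freq p k)) (freq p k) :=
    ((h p).continuousOn_phase (hη p) _ h0).mono (Ioi_subset_Ici h0)
  obtain ⟨s, hsc, hs⟩ := ((h1.eventually_lt_const hc).and self_mem_nhdsWithin).exists
  have hs0 : 0 < s := h0.trans_lt hs
  have h2 : ContinuousAt (fun q => phase (f q) s) p :=
    ContinuousAt.comp' ((h p).continuousAt_phase_left hs0) hf.continuousAt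
  filter_upwards [eventually_freq_lt hs, h2.eventually_lt_const hsc] with q hq hqc
  exact ((h q).strictMonoOn_phase (hη q) (freq_nonneg q k) hs0.le hq).trans hqc

variable (p k) in
/-- The angle `θ` for which `x ↦ sin (freq p k * x + θ)` is the `k`-th normalised eigenfunction. -/
def shift : ℝ := phase (reflect p.1.1) (freq p k)

variable (p k) in
theorem shift_eq : shift p k = (k + 1) * Real.pi - phase p.1.2 (freq p k) := by
  rw [shift, ← totalPhase_freq p k, totalPhase]
  ring

variable (k) in
theorem continuous_shift : Continuous fun p : Param mMinus mPlus => shift p k := by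
  rw [continuous_iff_continuousAt]
  intro p
  refine tendsto_order.2 ⟨fun a ha => ?_, fun b hb => ?_⟩
  -- The lower bound on one phase is the upper bound on the other, since their sum is fixed.
  · rw [show (fun p : Param mMinus mPlus => shift p k) p = shift p k from rfl, shift_eq] at ha
    filter_upwards [eventually_phase_freq_lt (f := fun q : Param mMinus mPlus => q.1.2)
      (continuous_snd.comp continuous_subtype_val) (fun q => q.plus_admissible)
      (fun q => q.abs_eta_plus_le) (lt_sub_comm.1 ha)] with q hq
    rw [shift_eq]
    linarith
  · exact eventually_phase_freq_lt (f := fun q : Param mMinus mPlus => reflect q.1.1)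
      (continuous_reflect.comp (continuous_fst.comp continuous_subtype_val))
      (fun q => q.reflect_minus_admissible) (fun q => q.abs_eta_reflect_minus_le) hb

theorem shift_of_freq_eq_zero (h : freq p k = 0) : shift p k = Real.pi / 2 := by
  rw [shift, h, phase_zero_eq_iff]
  exact (freq_eq_zero_iff.1 h).2.1

variable (p k) in
/-- The `k`-th normalised eigenfunction. -/
def eigenfun : C(Icc (-1 : ℝ) 1, ℝ) where
  toFun x := Real.sin (freq p k * x + shift p k)
  continuous_toFun := by fun_prop

variable (k) in
theorem continuous_eigenfun : Continuous fun p : Param mMinus mPlus => eigenfun p k := by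
  refine ContinuousMap.continuous_of_continuous_uncurry _ ?_
  have h1 := continuous_freq (mMinus := mMinus) (mPlus := mPlus) k
  have h2 := continuous_shift (mMinus := mMinus) (mPlus := mPlus) k
  exact Real.continuous_sin.comp (((h1.comp continuous_fst).mul
    (continuous_subtype_val.comp continuous_snd)).add (h2.comp continuous_fst))

end

/-! ### Solutions of the differential equation and the boundary conditions. -/

section

variable {m : ℕ} {d : BCData m} {ν s lam C θ : ℝ} {u : ℝ → ℝ}

theorem uniqueDiffOn_interval : UniqueDiffOn ℝ (Icc (-1 : ℝ) 1) :=
  uniqueDiffOn_Icc (by norm_num)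

theorem D_eq_of_eqOn {v : ℝ → ℝ} {v' x : ℝ} (h : EqOn u v (Icc (-1) 1)) (hx : x ∈ Icc (-1 : ℝ) 1)
    (hv : HasDerivAt v v' x) : D u x = v' := by
  rw [D, derivWithin_congr h (h hx)]
  exact hv.hasDerivWithinAt.derivWithin (uniqueDiffOn_interval x hx)

theorem contDiffOn_D (hu : ContDiffOn ℝ 2 u (Icc (-1) 1)) : ContDiffOn ℝ 1 (D u) (Icc (-1) 1) :=
  hu.derivWithin uniqueDiffOn_interval (by norm_num)

theorem hasDerivAt_D {v : ℝ → ℝ} (hv : ContDiffOn ℝ 1 v (Icc (-1) 1)) {x : ℝ}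
    (hx : x ∈ Ioo (-1 : ℝ) 1) : HasDerivAt v (D v x) x :=
  ((hv.differentiableOn (by norm_num) x (Ioo_subset_Icc_self hx)).hasDerivWithinAt).hasDerivAt
    (Icc_mem_nhds hx.1 hx.2)

theorem eq_of_hasDerivAt_zero {f : ℝ → ℝ} (hf : ContinuousOn f (Icc (-1) 1))
    (hd : ∀ x ∈ Ioo (-1 : ℝ) 1, HasDerivAt f 0 x) : ∀ x ∈ Icc (-1 : ℝ) 1, f x = f (-1) := by
  intro x hx
  rcases hx.1.eq_or_lt with rfl | h
  · rfl
  obtain ⟨c, -, hc⟩ := exists_hasDerivAt_eq_slope f (fun _ => 0) h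
    (hf.mono (Icc_subset_Icc_right hx.2)) fun y hy => hd y ⟨hy.1, hy.2.trans_le hx.2⟩
  rw [eq_comm, div_eq_zero_iff] at hc
  rcases hc with hc | hc <;> linarith

/-- The general solution of `-u'' = s² u`. -/
theorem exists_sin_form (hs : 0 < s) (hu : ContDiffOn ℝ 2 u (Icc (-1) 1))
    (heq : ∀ x ∈ Ioo (-1 : ℝ) 1, -(D (D u) x) = s ^ 2 * u x) :
    ∃ C θ : ℝ, ∀ x ∈ Icc (-1 : ℝ) 1, u x = C * Real.sin (s * x + θ) := by
  have hu1 : ContDiffOn ℝ 1 u (Icc (-1) 1) := hu.of_le (by norm_num)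
  have hcos : ∀ x : ℝ, HasDerivAt (fun x => Real.cos (s * x)) (-Real.sin (s * x) * s) x := fun x => by
    simpa using ((hasDerivAt_id x).const_mul s).cos
  have hsin : ∀ x : ℝ, HasDerivAt (fun x => Real.sin (s * x)) (Real.cos (s * x) * s) x := fun x => by
    simpa using ((hasDerivAt_id x).const_mul s).sin
  have cc : Continuous fun x => Real.cos (s * x) := by fun_prop
  have cs : Continuous fun x => Real.sin (s * x) := by fun_prop
  -- Rotating `(u', s u)` by the angle `-s x` gives a constant vector `(b, a)`; its polar form
  -- yields `C` and `θ`.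
  have h1 := eq_of_hasDerivAt_zero
    (f := fun x => s * (u x * Real.cos (s * x)) - D u x * Real.sin (s * x))
    ((continuousOn_const.mul (hu.continuousOn.mul cc.continuousOn)).sub
      ((contDiffOn_D hu).continuousOn.mul cs.continuousOn)) fun x hx => by
      refine ((((hasDerivAt_D hu1 hx).mul (hcos x)).const_mul s).sub
        ((hasDerivAt_D (contDiffOn_D hu) hx).mul (hsin x))).congr_deriv ?_
      linear_combination Real.sin (s * x) * heq x hx
  have h2 := eq_of_hasDerivAt_zero
    (f := fun x => s * (u x * Real.sin (s * x)) + D u x * Real.cos (s * x))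
    ((continuousOn_const.mul (hu.continuousOn.mul cs.continuousOn)).add
      ((contDiffOn_D hu).continuousOn.mul cc.continuousOn)) fun x hx => by
      refine ((((hasDerivAt_D hu1 hx).mul (hsin x)).const_mul s).add
        ((hasDerivAt_D (contDiffOn_D hu) hx).mul (hcos x))).congr_deriv ?_
      linear_combination -Real.cos (s * x) * heq x hx
  generalize s * (u (-1) * Real.cos (s * -1)) - D u (-1) * Real.sin (s * -1) = a at h1
  generalize s * (u (-1) * Real.sin (s * -1)) + D u (-1) * Real.cos (s * -1) = b at h2
  refine ⟨‖(⟨b, a⟩ : ℂ)‖ / s, (⟨b, a⟩ : ℂ).arg, fun x hx => ?_⟩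
  have e1 := Complex.norm_mul_cos_arg ⟨b, a⟩
  have e2 := Complex.norm_mul_sin_arg ⟨b, a⟩
  simp only at e1 e2
  rw [div_mul_eq_mul_div, eq_div_iff hs.ne', Real.sin_add]
  linear_combination -Real.sin (s * x) * e1 - Real.cos (s * x) * e2 +
    Real.cos (s * x) * h1 x hx + Real.sin (s * x) * h2 x hx -
    u x * s * Real.sin_sq_add_cos_sq (s * x)

theorem hasDerivAt_mul_sin (C s θ x : ℝ) :
    HasDerivAt (fun x => C * Real.sin (s * x + θ)) (C * (s * Real.cos (s * x + θ))) x := by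
  have := ((((hasDerivAt_id x).const_mul s).add_const θ).sin).const_mul C
  simpa [mul_comm, mul_left_comm] using this

theorem hasDerivAt_mul_cos (C s θ x : ℝ) :
    HasDerivAt (fun x => C * (s * Real.cos (s * x + θ))) (-(s ^ 2 * (C * Real.sin (s * x + θ)))) x := by
  have := (((((hasDerivAt_id x).const_mul s).add_const θ).cos).const_mul s).const_mul C
  refine this.congr_deriv ?_
  simp only [id]
  ring

theorem D_of_sin_form (hu : ∀ x ∈ Icc (-1 : ℝ) 1, u x = C * Real.sin (s * x + θ)) {x : ℝ}
    (hx : x ∈ Icc (-1 : ℝ) 1) : D u x = C * (s * Real.cos (s * x + θ)) :=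
  D_eq_of_eqOn hu hx (hasDerivAt_mul_sin C s θ x)

-- Each term is `Im (e^{i t} (a + i s b)) = a sin t + b s cos t`; the factor `e^{-i s (1 - ηᵢ)}`
-- moves `t` from `s + θ` to `s ηᵢ + θ`.
open Complex in
theorem im_exp_mul_symbol (d : BCData m) (s θ : ℝ) :
    (exp ((s + θ : ℝ) * I) * symbol d s).im =
      d.alpha0 * Real.sin (s + θ) + d.beta0 * (s * Real.cos (s + θ)) -
        (∑ i, d.alpha i * Real.sin (s * d.eta i + θ) +
          ∑ i, d.beta i * (s * Real.cos (s * d.eta i + θ))) := by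
  have key : ∀ a b t : ℝ, (exp ((t : ℝ) * I) * ((a : ℂ) + (s * b : ℝ) * I)).im =
      a * Real.sin t + b * (s * Real.cos t) := by
    intro a b t
    simp only [mul_im, add_re, add_im, ofReal_re, ofReal_im, mul_re, I_re, I_im,
      exp_ofReal_mul_I_re, exp_ofReal_mul_I_im]
    ring
  rw [symbol, mul_sub, sub_im, key, Finset.mul_sum, im_sum, ← Finset.sum_add_distrib]
  congr 1
  refine Finset.sum_congr rfl fun i _ => ?_
  rw [← key, mul_left_comm, ← exp_add, ← add_mul, ← ofReal_add, mul_comm]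
  congr 5
  ring

theorem im_exp_mul_symbol_eq (d : BCData m) (hs : 0 < s) (θ : ℝ) :
    (Complex.exp ((s + θ : ℝ) * Complex.I) * symbol d s).im =
      ‖symbol d s‖ * Real.sin (θ + phase d s) := by
  conv_lhs => rw [← Complex.norm_mul_exp_arg_mul_I (symbol d s)]
  rw [mul_left_comm, ← Complex.exp_add, ← add_mul, ← Complex.ofReal_add, Complex.im_ofReal_mul,
    Complex.exp_ofReal_mul_I_im, phase_of_pos d hs]
  congr 2
  ring

theorem CoeffAdmissible.boundaryCondition_one_iff (h : CoeffAdmissible 1 d)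
    (hη : ∀ i, |d.eta i| ≤ 1) (hs : 0 < s) (hC : C ≠ 0)
    (hu : ∀ x ∈ Icc (-1 : ℝ) 1, u x = C * Real.sin (s * x + θ)) :
    BoundaryCondition 1 d u ↔ Real.sin (θ + phase d s) = 0 := by
  have hQ : ‖symbol d s‖ ≠ 0 :=
    norm_ne_zero_iff.2 (Complex.slitPlane_ne_zero (h.symbol_mem_slitPlane hs))
  have hmem : ∀ i, d.eta i ∈ Icc (-1 : ℝ) 1 := fun i => abs_le.1 (hη i)
  have h1 : (1 : ℝ) ∈ Icc (-1 : ℝ) 1 := by norm_num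
  have key := im_exp_mul_symbol d s θ
  rw [im_exp_mul_symbol_eq d hs] at key
  have : Real.sin (θ + phase d s) = 0 ↔ C * (‖symbol d s‖ * Real.sin (θ + phase d s)) = 0 := by
    simp [hC, hQ]
  rw [this, key, BoundaryCondition, hu 1 h1, D_of_sin_form hu h1, ← sub_eq_zero]
  simp only [fun i => hu _ (hmem i), fun i => D_of_sin_form hu (hmem i), mul_sub, mul_add,
    Finset.mul_sum, mul_one]
  simp only [mul_left_comm]

/-- Reflection turns `sin (s x + θ)` into `-sin (s x - θ)`, so the symbol identity at `1` is used
with `-θ`. -/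
theorem CoeffAdmissible.boundaryCondition_neg_one_iff (h : CoeffAdmissible (-1) d)
    (hη : ∀ i, |d.eta i| ≤ 1) (hs : 0 < s) (hC : C ≠ 0)
    (hu : ∀ x ∈ Icc (-1 : ℝ) 1, u x = C * Real.sin (s * x + θ)) :
    BoundaryCondition (-1) d u ↔ Real.sin (θ - phase (MultiPoint.reflect d) s) = 0 := by
  have hQ : ‖symbol (MultiPoint.reflect d) s‖ ≠ 0 :=
    norm_ne_zero_iff.2 (Complex.slitPlane_ne_zero (h.reflect.symbol_mem_slitPlane hs))
  have hmem : ∀ i, d.eta i ∈ Icc (-1 : ℝ) 1 := fun i => abs_le.1 (hη i)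
  have h1 : (-1 : ℝ) ∈ Icc (-1 : ℝ) 1 := by norm_num
  have key := im_exp_mul_symbol (MultiPoint.reflect d) s (-θ)
  have hs0 : ∀ x, Real.sin (s * -x + -θ) = -Real.sin (s * x + θ) := fun x => by
    rw [← Real.sin_neg]; congr 1; ring
  have hc0 : ∀ x, Real.cos (s * -x + -θ) = Real.cos (s * x + θ) := fun x => by
    rw [← Real.cos_neg]; congr 1; ring
  have hs1 : Real.sin (s + -θ) = -Real.sin (s * -1 + θ) := by
    rw [← Real.sin_neg]; congr 1; ring
  have hc1 : Real.cos (s + -θ) = Real.cos (s * -1 + θ) := by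
    rw [← Real.cos_neg]; congr 1; ring
  rw [im_exp_mul_symbol_eq _ hs, neg_add_eq_sub, ← neg_sub θ, Real.sin_neg] at key
  simp only [reflect_alpha0, reflect_beta0, reflect_alpha, reflect_beta, reflect_eta, hs0, hc0,
    hs1, hc1] at key
  simp only [neg_mul, mul_neg, Finset.sum_neg_distrib] at key
  have : Real.sin (θ - phase (MultiPoint.reflect d) s) = 0 ↔
      C * (‖symbol (MultiPoint.reflect d) s‖ * Real.sin (θ - phase (MultiPoint.reflect d) s)) = 0 := by
    simp [hC, hQ]
  rw [this, neg_eq_iff_eq_neg.1 key, BoundaryCondition, hu (-1) h1, D_of_sin_form hu h1,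
    ← sub_eq_zero]
  simp only [fun i => hu _ (hmem i), fun i => D_of_sin_form hu (hmem i)]
  have e1 : ∑ i, d.alpha i * (C * Real.sin (s * d.eta i + θ)) =
      C * ∑ i, d.alpha i * Real.sin (s * d.eta i + θ) := by
    rw [Finset.mul_sum]; exact Finset.sum_congr rfl fun i _ => by ring
  have e2 : ∑ i, d.beta i * (C * (s * Real.cos (s * d.eta i + θ))) =
      C * ∑ i, d.beta i * (s * Real.cos (s * d.eta i + θ)) := by
    rw [Finset.mul_sum]; exact Finset.sum_congr rfl fun i _ => by ring
  rw [e1, e2, iff_iff_eq]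
  congr 1
  ring_nf

/-- The sign condition prevents cancellation between the two end point terms, and the nonlocal side
is smaller by the factors `a, b < 1`. -/
theorem CoeffAdmissible.eq_zero_of_boundaryCondition (h : CoeffAdmissible ν d) (hν : ν ^ 2 = 1)
    (hbc : BoundaryCondition ν d u) (hsign : 0 ≤ ν * (u ν * D u ν))
    (hu : ∀ i, |u (d.eta i)| ≤ |u ν|) (hD : ∀ i, |D u (d.eta i)| ≤ |D u ν|) :
    d.alpha0 * u ν = 0 ∧ d.beta0 * D u ν = 0 := by
  obtain ⟨a, b, ha, hb, hab, hA, hB⟩ := h.exists_ratio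
  have h0 := h.alpha0_nonneg
  have ha1 : a < 1 := by nlinarith
  have hb1 : b < 1 := by nlinarith
  have hmul : 0 ≤ (d.alpha0 * u ν) * (d.beta0 * D u ν) := by
    have := mul_nonneg h0 (mul_nonneg h.sign hsign)
    calc (0 : ℝ) ≤ _ := this
      _ = ν ^ 2 * ((d.alpha0 * u ν) * (d.beta0 * D u ν)) := by ring
      _ = _ := by rw [hν, one_mul]
  have hL : |d.alpha0 * u ν + d.beta0 * D u ν| = d.alpha0 * |u ν| + |d.beta0| * |D u ν| := by
    rw [(abs_add_eq_add_abs_iff _ _).2 (mul_nonneg_iff.1 hmul), abs_mul, abs_mul, abs_of_nonneg h0]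
  have hR : |∑ i, d.alpha i * u (d.eta i) + ∑ i, d.beta i * D u (d.eta i)| ≤
      a * d.alpha0 * |u ν| + b * |d.beta0| * |D u ν| := by
    rw [← hA, ← hB, Finset.sum_mul, Finset.sum_mul]
    refine (abs_add_le _ _).trans (add_le_add ?_ ?_)
    · refine (Finset.abs_sum_le_sum_abs _ _).trans (Finset.sum_le_sum fun i _ => ?_)
      rw [abs_mul]
      exact mul_le_mul_of_nonneg_left (hu i) (abs_nonneg _)
    · refine (Finset.abs_sum_le_sum_abs _ _).trans (Finset.sum_le_sum fun i _ => ?_)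
      rw [abs_mul]
      exact mul_le_mul_of_nonneg_left (hD i) (abs_nonneg _)
  rw [BoundaryCondition] at hbc
  rw [← hbc, hL] at hR
  have h1 : 0 ≤ d.alpha0 * |u ν| := by positivity
  have h2 : 0 ≤ |d.beta0| * |D u ν| := by positivity
  have h3 : d.alpha0 * |u ν| = 0 := by nlinarith
  have h4 : |d.beta0| * |D u ν| = 0 := by nlinarith
  simpa using And.intro h3 h4

/-! ### Exclusion of nonpositive eigenvalues, apart from the Neumann-type zero. -/

section Nonpositive

variable {mMinus mPlus : ℕ} {p : Param mMinus mPlus}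

/-- At an end point where `|u|` and `|u'|` are maximal, the boundary condition is of Neumann type
and `u'` vanishes. -/
theorem CoeffAdmissible.alpha0_eq_zero_and_D_eq_zero (h : CoeffAdmissible ν d) (hν : ν ^ 2 = 1)
    (hη : ∀ i, |d.eta i| ≤ 1) (hbc : BoundaryCondition ν d u) (hsign : 0 ≤ ν * (u ν * D u ν))
    (hne : u ν ≠ 0) (hu : ∀ x ∈ Icc (-1 : ℝ) 1, u x ^ 2 ≤ u ν ^ 2)
    (hD : ∀ x ∈ Icc (-1 : ℝ) 1, D u x ^ 2 ≤ D u ν ^ 2) : d.alpha0 = 0 ∧ D u ν = 0 := by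
  obtain ⟨h1, h2⟩ := h.eq_zero_of_boundaryCondition hν hbc hsign
    (fun i => sq_le_sq.1 (hu _ (abs_le.1 (hη i)))) (fun i => sq_le_sq.1 (hD _ (abs_le.1 (hη i))))
  have h3 : d.alpha0 = 0 := (mul_eq_zero.1 h1).resolve_right hne
  refine ⟨h3, (mul_eq_zero.1 h2).resolve_left fun h4 => ?_⟩
  have := h.nontrivial
  simp [h3, h4] at this

/-- For `lam ≤ 0`, `u u'` is nondecreasing, so `u²` is convex and maximal at an end point. As `u'² +
lam u²` is constant, `u'²` is maximal there too. The boundary condition then makes `u'` vanish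
there, hence everywhere, and `u` is a nonzero constant. -/
theorem IsEigenfunction.neumann_of_nonpos (h : IsEigenfunction p lam u) (hlam : lam ≤ 0) :
    lam = 0 ∧ p.1.1.alpha0 = 0 ∧ p.1.2.alpha0 = 0 := by
  have hu1 : ContDiffOn ℝ 1 u (Icc (-1) 1) := h.contDiffOn.of_le (by norm_num)
  have hD1 := contDiffOn_D h.contDiffOn
  have hd : ∀ x ∈ Ioo (-1 : ℝ) 1, HasDerivAt u (D u x) x := fun x hx => hasDerivAt_D hu1 hx
  have hdd : ∀ x ∈ Ioo (-1 : ℝ) 1, HasDerivAt (D u) (-(lam * u x)) x := fun x hx => by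
    rw [← h.equation x hx, neg_neg]
    exact hasDerivAt_D hD1 hx
  have m1 : (-1 : ℝ) ∈ Icc (-1 : ℝ) 1 := by norm_num
  have p1 : (1 : ℝ) ∈ Icc (-1 : ℝ) 1 := by norm_num
  have henergy := eq_of_hasDerivAt_zero (f := fun x => D u x ^ 2 + lam * u x ^ 2)
    ((hD1.continuousOn.pow 2).add (continuousOn_const.mul (hu1.continuousOn.pow 2)))
    fun x hx => by
      refine (((hdd x hx).pow 2).add (((hd x hx).pow 2).const_mul lam)).congr_deriv ?_
      norm_num
      ring
  have hmono : MonotoneOn (fun x => u x * D u x) (Icc (-1) 1) := by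
    have hdg : ∀ x ∈ Ioo (-1 : ℝ) 1, HasDerivAt (fun x => u x * D u x)
        (D u x * D u x + u x * (-(lam * u x))) x := fun x hx => (hd x hx).mul (hdd x hx)
    refine monotoneOn_of_deriv_nonneg (convex_Icc _ _) (hu1.continuousOn.mul hD1.continuousOn)
      (fun x hx => ?_) fun x hx => ?_ <;> rw [interior_Icc] at hx
    · exact (hdg x hx).differentiableAt.differentiableWithinAt
    · rw [(hdg x hx).deriv]
      nlinarith [mul_self_nonneg (D u x), mul_nonneg (neg_nonneg.2 hlam) (mul_self_nonneg (u x))]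
  have hmvt : ∀ a ∈ Icc (-1 : ℝ) 1, ∀ b ∈ Icc (-1 : ℝ) 1, a < b → ∃ c ∈ Icc (-1 : ℝ) 1,
      a ≤ c ∧ c ≤ b ∧ u b ^ 2 - u a ^ 2 = 2 * (u c * D u c) * (b - a) := by
    intro a ha b hb hab
    obtain ⟨c, hc, hc'⟩ := exists_hasDerivAt_eq_slope (fun x => u x ^ 2)
      (fun x => 2 * (u x * D u x)) hab
      ((hu1.continuousOn.pow 2).mono (Icc_subset_Icc ha.1 hb.2)) fun x hx =>
        ((hd x ⟨ha.1.trans_lt hx.1, hx.2.trans_le hb.2⟩).pow 2).congr_deriv (by norm_num; ring)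
    refine ⟨c, ⟨ha.1.trans hc.1.le, hc.2.le.trans hb.2⟩, hc.1.le, hc.2.le, ?_⟩
    rw [hc', div_mul_cancel₀ _ (sub_pos.2 hab).ne']
  have hright : ∀ x ∈ Icc (-1 : ℝ) 1, 0 ≤ u x * D u x → u x ^ 2 ≤ u 1 ^ 2 := by
    intro x hx hg
    rcases hx.2.eq_or_lt with rfl | hlt
    · rfl
    obtain ⟨c, hc, hxc, -, hc'⟩ := hmvt x hx 1 p1 hlt
    have : u x * D u x ≤ u c * D u c := hmono hx hc hxc
    have := mul_nonneg (mul_nonneg zero_le_two (hg.trans this)) (sub_pos.2 hlt).le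
    linarith
  have hleft : ∀ x ∈ Icc (-1 : ℝ) 1, u x * D u x ≤ 0 → u x ^ 2 ≤ u (-1) ^ 2 := by
    intro x hx hg
    rcases hx.1.eq_or_lt with heq | hlt
    · rw [heq]
    obtain ⟨c, hc, -, hxc, hc'⟩ := hmvt (-1) m1 x hx hlt
    have : u c * D u c ≤ u x * D u x := hmono hc hx hxc
    have := mul_nonneg (mul_nonneg zero_le_two (neg_nonneg.2 (this.trans hg))) (sub_pos.2 hlt).le
    linarith
  obtain ⟨x₀, hx₀, hne₀⟩ := h.nontrivial
  have hνne : ∀ ν : ℝ, (∀ x ∈ Icc (-1 : ℝ) 1, u x ^ 2 ≤ u ν ^ 2) → u ν ≠ 0 := fun ν hν h0 => by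
    have := hν x₀ hx₀
    rw [h0] at this
    exact hne₀ (by nlinarith)
  have hDle : ∀ ν ∈ Icc (-1 : ℝ) 1, (∀ x ∈ Icc (-1 : ℝ) 1, u x ^ 2 ≤ u ν ^ 2) →
      ∀ x ∈ Icc (-1 : ℝ) 1, D u x ^ 2 ≤ D u ν ^ 2 := fun ν hν hmax x hx => by
    have e1 := henergy x hx
    have e2 := henergy ν hν
    have := mul_nonneg (neg_nonneg.2 hlam) (sub_nonneg.2 (hmax x hx))
    linarith
  have hDzero : ∀ x ∈ Icc (-1 : ℝ) 1, D u x = 0 := by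
    -- The sign of `u u'` at `c` is that of `u(1)² - u(-1)²`; monotonicity carries it to the end
    -- point with the larger `u²`, giving the sign hypothesis there.
    obtain ⟨c, hc, hc1, hc2, hc3⟩ := hmvt (-1) m1 1 p1 (by norm_num)
    suffices ∃ ν ∈ Icc (-1 : ℝ) 1, (∀ x ∈ Icc (-1 : ℝ) 1, u x ^ 2 ≤ u ν ^ 2) ∧ D u ν = 0 by
      obtain ⟨ν, hν, hmax, h0⟩ := this
      intro x hx
      have := hDle ν hν hmax x hx
      rw [h0] at this
      nlinarith
    rcases le_total (u (-1) ^ 2) (u 1 ^ 2) with hle | hle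
    · have hmax : ∀ x ∈ Icc (-1 : ℝ) 1, u x ^ 2 ≤ u 1 ^ 2 := fun x hx =>
        (le_total 0 (u x * D u x)).elim (hright x hx) fun hg => (hleft x hx hg).trans hle
      have hg : u c * D u c ≤ u 1 * D u 1 := hmono hc p1 hc2
      exact ⟨1, p1, hmax, (p.plus_admissible.alpha0_eq_zero_and_D_eq_zero (by norm_num)
        p.abs_eta_plus_le h.bc_plus (by linarith) (hνne 1 hmax) hmax (hDle 1 p1 hmax)).2⟩
    · have hmax : ∀ x ∈ Icc (-1 : ℝ) 1, u x ^ 2 ≤ u (-1) ^ 2 := fun x hx =>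
        (le_total 0 (u x * D u x)).elim (fun hg => (hright x hx hg).trans hle) (hleft x hx)
      have hg : u (-1) * D u (-1) ≤ u c * D u c := hmono m1 hc hc1
      exact ⟨-1, m1, hmax, (p.2.1.alpha0_eq_zero_and_D_eq_zero (by norm_num)
        p.abs_eta_minus_le h.bc_minus (by linarith) (hνne _ hmax) hmax (hDle _ m1 hmax)).2⟩
  have hconst : ∀ ν ∈ Icc (-1 : ℝ) 1, ∀ x ∈ Icc (-1 : ℝ) 1, u x ^ 2 ≤ u ν ^ 2 := by
    have := eq_of_hasDerivAt_zero hu1.continuousOn fun x hx =>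
      hDzero x (Ioo_subset_Icc_self hx) ▸ hd x hx
    intro ν hν x hx
    rw [this x hx, this ν hν]
  obtain ⟨c, hc, hc'⟩ := exists_hasDerivAt_eq_slope (D u) (fun x => -(lam * u x))
    (show (-1 : ℝ) < 1 by norm_num) hD1.continuousOn hdd
  rw [hDzero _ m1, hDzero _ p1, sub_zero, zero_div, neg_eq_zero] at hc'
  refine ⟨(mul_eq_zero.1 hc').resolve_right (hνne c (hconst c (Ioo_subset_Icc_self hc))), ?_, ?_⟩
  · exact (p.2.1.alpha0_eq_zero_and_D_eq_zero (by norm_num) p.abs_eta_minus_le h.bc_minus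
      (by rw [hDzero _ m1]; simp) (hνne _ (hconst _ m1)) (hconst _ m1)
      (hDle _ m1 (hconst _ m1))).1
  · exact (p.plus_admissible.alpha0_eq_zero_and_D_eq_zero (by norm_num) p.abs_eta_plus_le h.bc_plus
      (by rw [hDzero _ p1]; simp) (hνne _ (hconst _ p1)) (hconst _ p1)
      (hDle _ p1 (hconst _ p1))).1

end Nonpositive

end

/-! ### Identification of the spectrum and of the normalised eigenfunctions. -/

section

variable {mMinus mPlus : ℕ} {p : Param mMinus mPlus} {k : ℕ} {lam s C θ : ℝ} {u : ℝ → ℝ}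

theorem isEigenfunction_iff_of_sin_form (hs : 0 < s) (hC : C ≠ 0)
    (hu : ∀ x ∈ Icc (-1 : ℝ) 1, u x = C * Real.sin (s * x + θ)) :
    IsEigenfunction p (s ^ 2) u ↔
      Real.sin (θ - phase (reflect p.1.1) s) = 0 ∧ Real.sin (θ + phase p.1.2 s) = 0 := by
  rw [← p.2.1.boundaryCondition_neg_one_iff p.abs_eta_minus_le hs hC hu,
    ← p.plus_admissible.boundaryCondition_one_iff p.abs_eta_plus_le hs hC hu]
  refine ⟨fun h => ⟨h.bc_minus, h.bc_plus⟩, fun h => ⟨?_, ?_, h.1, h.2, ?_⟩⟩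
  · have : ContDiff ℝ 2 fun x : ℝ => C * Real.sin (s * x + θ) := by fun_prop
    exact this.contDiffOn.congr hu
  · intro x hx
    have hx' := Ioo_subset_Icc_self hx
    rw [D_eq_of_eqOn (fun y hy => D_of_sin_form hu hy) hx' (hasDerivAt_mul_cos C s θ x), hu x hx',
      neg_neg]
  · have h0 : (0 : ℝ) ∈ Icc (-1 : ℝ) 1 := by norm_num
    by_contra! hcon
    have e1 := hcon 0 h0
    have e2 : D u 0 = 0 := D_eq_of_eqOn hcon h0 (hasDerivAt_const 0 0)
    rw [hu 0 h0] at e1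
    rw [D_of_sin_form hu h0] at e2
    have e3 := (mul_eq_zero.1 e1).resolve_left hC
    have e4 := (mul_eq_zero.1 ((mul_eq_zero.1 e2).resolve_left hC)).resolve_left hs.ne'
    have := Real.sin_sq_add_cos_sq (s * 0 + θ)
    rw [e3, e4] at this
    norm_num at this

theorem isEigenfunction_zero (h1 : p.1.1.alpha0 = 0) (h2 : p.1.2.alpha0 = 0)
    (hu : ∀ x ∈ Icc (-1 : ℝ) 1, u x = 1) : IsEigenfunction p 0 u := by
  have hD : ∀ x ∈ Icc (-1 : ℝ) 1, D u x = 0 := fun x hx => D_eq_of_eqOn hu hx (hasDerivAt_const x 1)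
  have hbc : ∀ {m : ℕ} {ν : ℝ} {d : BCData m}, CoeffAdmissible ν d → d.alpha0 = 0 →
      ν ∈ Icc (-1 : ℝ) 1 → (∀ i, |d.eta i| ≤ 1) → BoundaryCondition ν d u := by
    intro m ν d h h0 hν hη
    have hα := h.alpha_eq_zero h0
    rw [Finset.sum_eq_zero_iff_of_nonneg fun i _ => abs_nonneg _] at hα
    have hα' : ∀ i, d.alpha i = 0 := fun i => abs_eq_zero.1 (hα i (Finset.mem_univ i))
    rw [BoundaryCondition, h0, hD ν hν]
    simp [hα', fun i => hD _ (abs_le.1 (hη i))]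
  refine ⟨(contDiffOn_const (c := (1 : ℝ))).congr hu, fun x hx => ?_,
    hbc p.2.1 h1 (by norm_num) p.abs_eta_minus_le, hbc p.2.2.1 h2 (by norm_num) p.abs_eta_plus_le,
    0, by norm_num, by rw [hu 0 (by norm_num)]; norm_num⟩
  rw [D_eq_of_eqOn hD (Ioo_subset_Icc_self hx) (hasDerivAt_const x 0)]
  simp

theorem freq_sq_strictMono : StrictMono fun k => freq p k ^ 2 := fun _ _ h =>
  pow_lt_pow_left₀ (freq_strictMono h) (freq_nonneg p _) two_ne_zero

variable (p k) in
theorem extendC_eigenfun {x : ℝ} (hx : x ∈ Icc (-1 : ℝ) 1) :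
    extendC (eigenfun p k) x = Real.sin (freq p k * x + shift p k) := by
  rw [extendC, IccExtend_of_mem _ _ hx]
  rfl

variable (p k) in
theorem isEigenfunction_eigenfun : IsEigenfunction p (freq p k ^ 2) (extendC (eigenfun p k)) := by
  rcases (freq_nonneg p k).eq_or_lt with h | h
  · have h0 := freq_eq_zero_iff.1 h.symm
    rw [← h, zero_pow two_ne_zero]
    refine isEigenfunction_zero h0.2.1 h0.2.2 fun x hx => ?_
    rw [extendC_eigenfun p k hx, ← h, shift_of_freq_eq_zero h.symm]
    simp
  · rw [isEigenfunction_iff_of_sin_form h one_ne_zero fun x hx => by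
      rw [extendC_eigenfun p k hx, one_mul]]
    constructor
    · rw [shift, sub_self, Real.sin_zero]
    · rw [shift_eq, sub_add_cancel]
      exact_mod_cast Real.sin_nat_mul_pi (k + 1)

theorem exists_eq_freq_sq (h : IsEigenfunction p lam u) : ∃ k, freq p k ^ 2 = lam := by
  rcases le_or_gt lam 0 with hlam | hlam
  · obtain ⟨rfl, h1, h2⟩ := h.neumann_of_nonpos hlam
    exact ⟨0, by rw [freq_eq_zero_iff.2 ⟨rfl, h1, h2⟩]; norm_num⟩
  obtain ⟨s, hs, rfl⟩ : ∃ s, 0 < s ∧ lam = s ^ 2 := 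
    ⟨_, Real.sqrt_pos.2 hlam, (Real.sq_sqrt hlam.le).symm⟩
  obtain ⟨C, θ, hu⟩ := exists_sin_form hs h.contDiffOn h.equation
  have hC : C ≠ 0 := by
    rintro rfl
    obtain ⟨x, hx, hne⟩ := h.nontrivial
    exact hne (by rw [hu x hx, zero_mul])
  obtain ⟨h1, h2⟩ := (isEigenfunction_iff_of_sin_form hs hC hu).1 h
  obtain ⟨a, ha⟩ := Real.sin_eq_zero_iff.1 h1
  obtain ⟨b, hb⟩ := Real.sin_eq_zero_iff.1 h2
  have htot : totalPhase p s = ((b - a : ℤ) : ℝ) * Real.pi := by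
    rw [totalPhase]
    push_cast
    linarith
  have hpos : 0 < totalPhase p s :=
    (totalPhase_zero_nonneg p).trans_lt (strictMonoOn_totalPhase p self_mem_Ici hs.le hs)
  rw [htot] at hpos
  have hn : 0 < b - a := by exact_mod_cast (pos_iff_pos_of_mul_pos hpos).2 Real.pi_pos
  -- The total phase is positive for `s > 0`, so its multiples of `π` start at `1`, and the multiple
  -- `b - a` has index `b - a - 1`.
  obtain ⟨k, hk⟩ := Int.eq_ofNat_of_zero_le (show 0 ≤ b - a - 1 by omega)
  refine ⟨k, ?_⟩
  rw [← eq_freq hs.le]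
  rw [htot, show b - a = k + 1 by omega]
  push_cast
  ring

theorem range_freq_sq : range (fun k => freq p k ^ 2) = spec p := by
  ext lam
  constructor
  · rintro ⟨k, rfl⟩
    exact ⟨_, isEigenfunction_eigenfun p k⟩
  · rintro ⟨u, hu⟩
    exact exists_eq_freq_sq hu

theorem omegaMinus_sq (hs : 0 ≤ s) : omegaMinus p (s ^ 2) = baseAngle (reflect p.1.1) s := by
  simp only [omegaMinus, baseAngle, reflect_alpha0, reflect_beta0, Real.sqrt_sq hs, mul_neg,
    neg_div, Real.arctan_neg]

theorem omegaPlus_sq (hs : 0 ≤ s) : omegaPlus p (s ^ 2) = Real.pi - baseAngle p.1.2 s := by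
  simp only [omegaPlus, baseAngle, Real.sqrt_sq hs]
  split_ifs
  · ring
  · rfl

theorem isPruferAngle_of_sin_form (hs : 0 < s)
    (hu : ∀ x ∈ Icc (-1 : ℝ) 1, u x = Real.sin (s * x + θ)) :
    IsPruferAngle (s ^ 2) u fun x => s * x + θ := by
  refine ⟨Continuous.continuousOn (by fun_prop), fun x hx => ⟨s, hs, ?_, ?_⟩⟩
  · rw [D_of_sin_form (C := 1) (fun x hx => by rw [hu x hx, one_mul]) hx, one_mul]
  · rw [Real.sqrt_sq hs.le, hu x hx]

-- For positive frequency `s` the Prüfer angle is `s x + shift p k`. At `-1` it equals the argument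
-- of the reflected symbol, and at `1` it equals `(k + 1) π` minus the argument of the symbol, so
-- both oscillation conditions are `abs_arg_symbol_sub_lt`.
variable (p k) in
theorem isNormalizedEigenfunction_eigenfun :
    IsNormalizedEigenfunction p k (freq p k ^ 2) (extendC (eigenfun p k)) := by
  refine ⟨isEigenfunction_eigenfun p k, ⟨shift p k, fun x hx => ?_⟩, fun hne => ?_, fun h0 x hx => ?_⟩
  · rw [extendC_eigenfun p k hx, Real.sqrt_sq (freq_nonneg p k)]
  · have hs : 0 < freq p k := (freq_nonneg p k).lt_of_ne' (by simpa using hne)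
    refine ⟨by positivity, (isEigenfunction_eigenfun p k).contDiffOn.of_le (by norm_num), _,
      isPruferAngle_of_sin_form hs fun x hx => extendC_eigenfun p k hx, ?_, ?_⟩
    · rw [omegaMinus_sq hs.le, shift, phase_of_pos _ hs]
      convert p.reflect_minus_admissible.abs_arg_symbol_sub_lt hs using 2
      ring
    · rw [omegaPlus_sq hs.le, shift_eq, phase_of_pos _ hs]
      convert p.plus_admissible.abs_arg_symbol_sub_lt hs using 1
      rw [← abs_neg]
      congr 1
      ring
  · have hs : freq p k = 0 := by simpa using h0
    rw [extendC_eigenfun p k hx, hs, shift_of_freq_eq_zero hs]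
    simp

/-- For positive frequency the boundary condition at `-1` fixes `θ` modulo `π`, and the Prüfer
condition at `-1` removes the remaining choice of sign. -/
theorem IsNormalizedEigenfunction.eq_sin (h : IsNormalizedEigenfunction p k (freq p k ^ 2) u)
    {x : ℝ} (hx : x ∈ Icc (-1 : ℝ) 1) : u x = Real.sin (freq p k * x + shift p k) := by
  rcases (freq_nonneg p k).eq_or_lt with h0 | hs
  · rw [h.of_eq_zero (by rw [← h0]; norm_num) x hx, ← h0, shift_of_freq_eq_zero h0.symm]
    simp
  obtain ⟨θ, hθ⟩ := h.form
  rw [Real.sqrt_sq hs.le] at hθ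
  have hθ' : ∀ x ∈ Icc (-1 : ℝ) 1, u x = 1 * Real.sin (freq p k * x + θ) := fun x hx => by
    rw [hθ x hx, one_mul]
  obtain ⟨h1, -⟩ := (isEigenfunction_iff_of_sin_form hs one_ne_zero hθ').1 h.eigenfunction
  obtain ⟨n, hn⟩ := Real.sin_eq_zero_iff.1 h1
  obtain ⟨-, -, ω, ⟨-, hω⟩, hω1, -⟩ := h.oscillation (by positivity)
  have m1 : (-1 : ℝ) ∈ Icc (-1 : ℝ) 1 := by norm_num
  obtain ⟨ρ, hρ, hc, hsn⟩ := hω (-1) m1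
  rw [D_of_sin_form hθ' m1, one_mul] at hc
  rw [Real.sqrt_sq hs.le, hθ _ m1] at hsn
  have hρs : ρ = freq p k := by
    refine (pow_left_inj₀ hρ.le hs.le two_ne_zero).1 ?_
    have e1 := Real.sin_sq_add_cos_sq (freq p k * -1 + θ)
    have e2 := Real.sin_sq_add_cos_sq (ω (-1))
    calc ρ ^ 2 = (ρ * Real.sin (ω (-1))) ^ 2 + (ρ * Real.cos (ω (-1))) ^ 2 := by
          linear_combination -ρ ^ 2 * e2
      _ = freq p k ^ 2 := by rw [← hc, ← hsn]; linear_combination freq p k ^ 2 * e1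
  rw [hρs] at hc hsn
  have hang : (ω (-1) : Real.Angle) = (freq p k * -1 + θ : ℝ) :=
    Real.Angle.cos_sin_inj (mul_left_cancel₀ hs.ne' hc).symm (mul_left_cancel₀ hs.ne' hsn).symm
  obtain ⟨l, hl⟩ := Real.Angle.angle_eq_iff_two_pi_dvd_sub.1 hang
  have hb := p.reflect_minus_admissible.abs_arg_symbol_sub_lt hs
  have hph := phase_of_pos (reflect p.1.1) hs
  rw [omegaMinus_sq hs.le, abs_lt] at hω1
  rw [abs_lt] at hb
  have hπ := Real.pi_pos
  -- Both angles lie within `π/2` of the same base angle, so this multiple of `π` is less than `π`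
  -- in absolute value and vanishes; hence `n` is even.
  have hdiff : ω (-1) - (symbol (reflect p.1.1) (freq p k)).arg = ((n + 2 * l : ℤ) : ℝ) * Real.pi := by
    push_cast
    linarith
  have hlt : n + 2 * l < 1 := by
    have : ((n + 2 * l : ℤ) : ℝ) < 1 := by nlinarith
    exact_mod_cast this
  have hgt : -1 < n + 2 * l := by
    have : (-1 : ℝ) < ((n + 2 * l : ℤ) : ℝ) := by nlinarith
    exact_mod_cast this
  have hnl : n = (-l) * 2 := by omega
  have hθs : θ = shift p k + ((-l : ℤ) : ℝ) * (2 * Real.pi) := by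
    rw [shift]
    rw [hnl] at hn
    push_cast at hn ⊢
    linarith
  rw [hθ x hx, hθs, ← add_assoc, Real.sin_add_int_mul_two_pi]

theorem isNormalizedEigenfunction_iff (f : C(Icc (-1 : ℝ) 1, ℝ)) :
    IsNormalizedEigenfunction p k (freq p k ^ 2) (extendC f) ↔ f = eigenfun p k := by
  constructor
  · intro h
    ext ⟨x, hx⟩
    have := h.eq_sin hx
    rwa [extendC, IccExtend_of_mem _ _ hx] at this
  · rintro rfl
    exact isNormalizedEigenfunction_eigenfun p k

end

end MultiPoint

end

theorem corollary4p8 (mMinus mPlus : ℕ) (_hMinus : 1 ≤ mMinus) (_hPlus : 1 ≤ mPlus) :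
    ∃ (lam : ℕ → MultiPoint.Param mMinus mPlus → ℝ)
      (u : ℕ → MultiPoint.Param mMinus mPlus → C(Set.Icc (-1 : ℝ) 1, ℝ)),
      -- the eigenvalues of the problem with parameter `p`, in strictly increasing order
      (∀ p, StrictMono (fun k => lam k p) ∧
        Set.range (fun k => lam k p) = MultiPoint.spec p) ∧
      -- `u k p` is the normalised eigenfunction of the `k`-th eigenvalue
      (∀ k p (f : C(Set.Icc (-1 : ℝ) 1, ℝ)),
        MultiPoint.IsNormalizedEigenfunction p k (lam k p) (MultiPoint.extendC f) ↔ f = u k p) ∧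
      -- both depend continuously on the parameter
      ∀ k, Continuous (lam k) ∧ Continuous (u k) :=
  ⟨fun k p => MultiPoint.freq p k ^ 2, fun k p => MultiPoint.eigenfun p k,
    fun _ => ⟨MultiPoint.freq_sq_strictMono, MultiPoint.range_freq_sq⟩,
    fun _ _ => MultiPoint.isNormalizedEigenfunction_iff,
    fun k => ⟨(MultiPoint.continuous_freq k).pow 2, MultiPoint.continuous_eigenfun k⟩⟩
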